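/- All Lie algebras are real. A complex product structure on a Lie algebra $\mathfrak g$ is a pair $\{J,E\}$ of linear endomorphisms of $\mathfrak g$ with $J^2=-\mathrm{Id}$, $E^2=\mathrm{Id}$, $E\neq\pm\mathrm{Id}$, $JE=-EJ$, and, for all $x,y\in\mathfrak g$, $$J[x,y]=[Jx,y]+[x,Jy]+J[Jx,Jy],\qquad E[x,y]=[Ex,y]+[x,Ey]-E[Ex,Ey].$$ It determines a unique bilinear map $\nabla:\mathfrak g\times\mathfrak g\to\mathfrak g$ with $\nabla_xy-\nabla_yx=[x,y]$, $\nabla_xJy=J\nabla_xy$ and $\nabla_xEy=E\nabla_xy$ for all $x,y$. The structure $\{J,E\}$ is called flat if $\nabla_x\nabla_y-\nabla_y\nabla_x-\nabla_{[x,y]}=0$ for all $x,y\in\mathfrak g$, and non-flat otherwise. A tuple such as $(0,0,0,12,13+14,24)$ denotes the 6-dimensional (nilpotent) Lie algebra having a basis whose dual basis $e^1,\dots,e^6$ satisfies $de^1=de^2=de^3=0$, $de^4=e^1\wedge e^2$, $de^5=e^1\wedge e^3+e^1\wedge e^4$, $de^6=e^2\wedge e^4$, where $(df)(x\wedge y)=-f([x,y])$;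 similarly for the other tuples. **Theorem 6.3.** (i) Each of the following Lie algebras admits complex product structures, and all of them are flat: $(0,0,0,0,0,0)$, $(0,0,0,0,0,12)$, $(0,0,0,0,0,12+34)$, $(0,0,0,0,12,13)$, $(0,0,0,0,13+42,14+23)$, $(0,0,0,0,12,14+23)$, $(0,0,0,0,12,34)$, $(0,0,0,12,13,23)$, $(0,0,0,12,13,14+23)$. (ii) Each of the following Lie algebras admits complex product structures, and none of them is flat: $(0,0,0,12,14,24)$, $(0,0,0,12,13,24)$. (iii) Each of the following Lie algebras admits both flat and non-flat complex product structures: $(0,0,0,0,12,14+25)$, $(0,0,0,12,13,14)$, $(0,0,0,12,13+14,24)$, $(0,0,0,12,14,13+42)$. -/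

import Mathlib

namespace ComplexProduct

section Structures

variable {g : Type*} [LieRing g] [LieAlgebra ℝ g]

/-- An (integrable) complex structure on a real Lie algebra: a linear endomorphism with
`J² = -Id` satisfying `J[x,y] = [Jx,y] + [x,Jy] + J[Jx,Jy]`. -/
structure IsComplexStructure (J : g →ₗ[ℝ] g) : Prop where
  sq : ∀ x, J (J x) = -x
  integrable : ∀ x y, J ⁅x, y⁆ = ⁅J x, y⁆ + ⁅x, J y⁆ + J ⁅J x, J y⁆

/-- An (integrable) product structure on a real Lie algebra: a linear endomorphism with
`E² = Id`, different from `± Id`, satisfying `E[x,y] = [Ex,y] + [x,Ey] - E[Ex,Ey]`. -/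
structure IsProductStructure (E : g →ₗ[ℝ] g) : Prop where
  sq : ∀ x, E (E x) = x
  ne_id : E ≠ LinearMap.id
  ne_neg_id : E ≠ -LinearMap.id
  integrable : ∀ x y, E ⁅x, y⁆ = ⁅E x, y⁆ + ⁅x, E y⁆ - E ⁅E x, E y⁆

variable (g) in
/-- A complex product structure `{J, E}`: a complex structure and a product structure that
anticommute. -/
structure CPStructure where
  J : g →ₗ[ℝ] g
  E : g →ₗ[ℝ] g
  complex : IsComplexStructure J
  product : IsProductStructure E
  anticomm : ∀ x, J (E x) = -E (J x)

namespace CPStructure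

variable (S : CPStructure g)

/-- A connection on `g` is a `g`-valued bilinear form `(x, y) ↦ ∇ x y`. This says that `∇` is
torsion-free and that `J` and `E` are `∇`-parallel. -/
structure IsAssociated (nab : g →ₗ[ℝ] g →ₗ[ℝ] g) : Prop where
  torsionFree : ∀ x y, nab x y - nab y x = ⁅x, y⁆
  parallel_J : ∀ x y, nab x (S.J y) = S.J (nab x y)
  parallel_E : ∀ x y, nab x (S.E y) = S.E (nab x y)

/-- The projection onto the `+1` eigenspace of `E`. -/
noncomputable def projPos : g →ₗ[ℝ] g := (1 / 2 : ℝ) • (LinearMap.id + S.E)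

/-- The projection onto the `-1` eigenspace of `E`. -/
noncomputable def projNeg : g →ₗ[ℝ] g := (1 / 2 : ℝ) • (LinearMap.id - S.E)

/-- The bilinear form given by
`∇ x₊ y₊ = -π₊J[x₊,Jy₊]`, `∇ x₋ y₋ = -π₋J[x₋,Jy₋]`, `∇ x₊ y₋ = π₋[x₊,y₋]`,
`∇ x₋ y₊ = π₊[x₋,y₊]`. -/
noncomputable def explicitConnection : g →ₗ[ℝ] g →ₗ[ℝ] g :=
  LinearMap.mk₂ ℝ
    (fun x y =>
      -S.projPos (S.J ⁅S.projPos x, S.J (S.projPos y)⁆)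
        - S.projNeg (S.J ⁅S.projNeg x, S.J (S.projNeg y)⁆)
        + S.projNeg ⁅S.projPos x, S.projNeg y⁆
        + S.projPos ⁅S.projNeg x, S.projPos y⁆)
    (by intro x x' y; simp only [map_add, add_lie]; abel)
    (by intro c x y; simp only [map_smul, smul_lie, smul_add, smul_sub, smul_neg])
    (by intro x y y'; simp only [map_add, lie_add]; abel)
    (by intro c x y; simp only [map_smul, lie_smul, smul_add, smul_sub, smul_neg])

theorem explicitConnection_apply (x y : g) : S.explicitConnection x y =
    -S.projPos (S.J ⁅S.projPos x, S.J (S.projPos y)⁆)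
      - S.projNeg (S.J ⁅S.projNeg x, S.J (S.projNeg y)⁆)
      + S.projNeg ⁅S.projPos x, S.projNeg y⁆
      + S.projPos ⁅S.projNeg x, S.projPos y⁆ := rfl

theorem projPos_apply (x : g) : S.projPos x = (1 / 2 : ℝ) • (x + S.E x) := rfl

theorem projNeg_apply (x : g) : S.projNeg x = (1 / 2 : ℝ) • (x - S.E x) := rfl

theorem projPos_add_projNeg (x : g) : S.projPos x + S.projNeg x = x := by
  rw [projPos_apply, projNeg_apply]; module

theorem E_projPos (x : g) : S.E (S.projPos x) = S.projPos x := by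
  simp only [projPos_apply, map_smul, map_add, S.product.sq]; module

theorem E_projNeg (x : g) : S.E (S.projNeg x) = -S.projNeg x := by
  simp only [projNeg_apply, map_smul, map_sub, S.product.sq]; module

theorem projPos_E (x : g) : S.projPos (S.E x) = S.projPos x := by
  simp only [projPos_apply, S.product.sq]; module

theorem projNeg_E (x : g) : S.projNeg (S.E x) = -S.projNeg x := by
  simp only [projNeg_apply, S.product.sq]; module

theorem J_projPos (x : g) : S.J (S.projPos x) = S.projNeg (S.J x) := by
  simp only [projPos_apply, projNeg_apply, map_smul, map_add, S.anticomm]; module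

theorem J_projNeg (x : g) : S.J (S.projNeg x) = S.projPos (S.J x) := by
  simp only [projPos_apply, projNeg_apply, map_smul, map_sub, S.anticomm]; module

theorem projNeg_lie_of_pos {a b : g} (ha : S.E a = a) (hb : S.E b = b) :
    S.projNeg ⁅a, b⁆ = 0 := by
  have h := S.product.integrable a b
  rw [ha, hb] at h
  have h2 : S.E ⁅a, b⁆ = ⁅a, b⁆ := by
    have h3 : (2 : ℝ) • S.E ⁅a, b⁆ = (2 : ℝ) • ⁅a, b⁆ := by
      rw [two_smul, two_smul]; nth_rewrite 1 [h]; abel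
    exact smul_right_injective g (two_ne_zero' ℝ) h3
  rw [projNeg_apply, h2, sub_self, smul_zero]

theorem projPos_lie_of_neg {a b : g} (ha : S.E a = -a) (hb : S.E b = -b) :
    S.projPos ⁅a, b⁆ = 0 := by
  have h := S.product.integrable a b
  rw [ha, hb] at h
  simp only [neg_lie, lie_neg, neg_neg] at h
  have h2 : S.E ⁅a, b⁆ = -⁅a, b⁆ := by
    have h3 : (2 : ℝ) • S.E ⁅a, b⁆ = (2 : ℝ) • -⁅a, b⁆ := by
      rw [two_smul, two_smul]; nth_rewrite 1 [h]; abel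
    exact smul_right_injective g (two_ne_zero' ℝ) h3
  rw [projPos_apply, h2, add_neg_cancel, smul_zero]

theorem J_lie_sub (a b : g) : S.J ⁅a, S.J b⁆ - S.J ⁅b, S.J a⁆ = ⁅S.J a, S.J b⁆ - ⁅a, b⁆ := by
  have h := congrArg S.J (S.complex.integrable a b)
  simp only [map_add, S.complex.sq] at h
  rw [← lie_skew b (S.J a), map_neg]
  linear_combination (norm := module) -h

theorem explicitConnection_isAssociated : S.IsAssociated S.explicitConnection := by
  refine ⟨fun x y => ?_, fun x y => ?_, fun x y => ?_⟩
  · rw [explicitConnection_apply, explicitConnection_apply]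
    set a := S.projPos x with ha
    set a' := S.projNeg x with ha'
    set b := S.projPos y with hb
    set b' := S.projNeg y with hb'
    have hJpos : ∀ z, S.E (S.J (S.projPos z)) = -S.J (S.projPos z) := fun z => by
      rw [J_projPos, E_projNeg]
    have hJneg : ∀ z, S.E (S.J (S.projNeg z)) = S.J (S.projNeg z) := fun z => by
      rw [J_projNeg, E_projPos]
    have h1 := congrArg S.projPos (S.J_lie_sub a b)
    have h2 := congrArg S.projNeg (S.J_lie_sub a' b')
    rw [map_sub, map_sub, S.projPos_lie_of_neg (hJpos x) (hJpos y)] at h1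
    rw [map_sub, map_sub, S.projNeg_lie_of_pos (hJneg x) (hJneg y)] at h2
    have h3 : S.projPos ⁅a, b⁆ = ⁅a, b⁆ := by
      have := S.projPos_add_projNeg ⁅a, b⁆
      rwa [S.projNeg_lie_of_pos (S.E_projPos x) (S.E_projPos y), add_zero] at this
    have h4 : S.projNeg ⁅a', b'⁆ = ⁅a', b'⁆ := by
      have := S.projPos_add_projNeg ⁅a', b'⁆
      rwa [S.projPos_lie_of_neg (S.E_projNeg x) (S.E_projNeg y), zero_add] at this
    have h5 := S.projPos_add_projNeg ⁅a, b'⁆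
    have h6 := S.projPos_add_projNeg ⁅a', b⁆
    have h7 : ⁅x, y⁆ = ⁅a, b⁆ + ⁅a', b'⁆ + ⁅a, b'⁆ + ⁅a', b⁆ := by
      rw [← S.projPos_add_projNeg x, ← S.projPos_add_projNeg y]
      simp only [add_lie, lie_add, ← ha, ← ha', ← hb, ← hb']
      abel
    rw [h7, ← lie_skew b a', ← lie_skew b' a, map_neg, map_neg]
    linear_combination (norm := module) -h1 - h2 + h3 + h4 + h5 + h6
  · rw [explicitConnection_apply, explicitConnection_apply]
    simp only [← J_projPos, ← J_projNeg, S.complex.sq, map_add, map_sub, map_neg, lie_neg, neg_neg]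
    abel
  · rw [explicitConnection_apply, explicitConnection_apply]
    simp only [projPos_E, projNeg_E, E_projPos, E_projNeg, map_add, map_sub, map_neg, lie_neg]

/-- A complex product structure determines uniquely a torsion-free connection for which `J` and
`E` are parallel. -/
theorem existsUnique_isAssociated : ∃! nab : g →ₗ[ℝ] g →ₗ[ℝ] g, S.IsAssociated nab := by
  refine ⟨S.explicitConnection, S.explicitConnection_isAssociated, fun nab h => ?_⟩
  have h' := S.explicitConnection_isAssociated
  set nab' := S.explicitConnection
  have hs : ∀ x y, nab x y - nab' x y = nab y x - nab' y x := by
    intro x y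
    have := (h.torsionFree x y).trans (h'.torsionFree x y).symm
    linear_combination (norm := module) this
  have hJ : ∀ x y, nab x (S.J y) - nab' x (S.J y) = S.J (nab x y - nab' x y) := by
    intro x y; rw [h.parallel_J, h'.parallel_J, map_sub]
  have hE : ∀ x y, nab x (S.E y) - nab' x (S.E y) = S.E (nab x y - nab' x y) := by
    intro x y; rw [h.parallel_E, h'.parallel_E, map_sub]
  ext x y
  have key : S.J (S.E (nab x y - nab' x y)) = S.E (S.J (nab x y - nab' x y)) := by
    calc S.J (S.E (nab x y - nab' x y)) = nab (S.E y) (S.J x) - nab' (S.E y) (S.J x) := by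
          rw [hJ, hs (S.E y) x, hE]
      _ = S.E (S.J (nab x y - nab' x y)) := by
          rw [← hs, hE, hs (S.J x) y, hJ, hs y x]
  rw [S.anticomm] at key
  have h0 : S.E (S.J (nab x y - nab' x y)) = 0 := by
    have h2 : (2 : ℝ) • S.E (S.J (nab x y - nab' x y)) = 0 := by
      linear_combination (norm := module) -key
    exact (smul_eq_zero.mp h2).resolve_left two_ne_zero
  have h1 : nab x y - nab' x y = 0 := by
    have h2 := congrArg S.E h0
    rw [S.product.sq, map_zero] at h2
    have h3 := congrArg S.J h2
    rw [S.complex.sq, map_zero] at h3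
    exact neg_eq_zero.mp h3
  exact sub_eq_zero.mp h1

/-- The torsion-free connection `∇` determined by `{J, E}`, i.e. the unique torsion-free
connection with `∇J = ∇E = 0`. -/
noncomputable def connection : g →ₗ[ℝ] g →ₗ[ℝ] g := S.existsUnique_isAssociated.choose

theorem connection_isAssociated : S.IsAssociated S.connection :=
  S.existsUnique_isAssociated.choose_spec.1

theorem eq_connection {nab : g →ₗ[ℝ] g →ₗ[ℝ] g} (h : S.IsAssociated nab) : nab = S.connection :=
  S.existsUnique_isAssociated.choose_spec.2 nab h

/-- The curvature `R(x,y)z = ∇ x (∇ y z) - ∇ y (∇ x z) - ∇ [x,y] z` of the associated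
torsion-free connection. -/
noncomputable def curvature (x y z : g) : g :=
  S.connection x (S.connection y z) - S.connection y (S.connection x z) - S.connection ⁅x, y⁆ z

/-- A complex product structure is flat if its associated torsion-free connection is flat. -/
def IsFlat : Prop := ∀ x y z, S.curvature x y z = 0

end CPStructure

variable (g) in
/-- `g` admits complex product structures, and all of them are flat. -/
def AdmitsOnlyFlat : Prop := Nonempty (CPStructure g) ∧ ∀ S : CPStructure g, S.IsFlat

variable (g) in
/-- `g` admits complex product structures, and none of them is flat. -/
def AdmitsOnlyNonFlat : Prop := Nonempty (CPStructure g) ∧ ∀ S : CPStructure g, ¬ S.IsFlat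

variable (g) in
/-- `g` admits both flat and non-flat complex product structures. -/
def AdmitsFlatAndNonFlat : Prop :=
  (∃ S : CPStructure g, S.IsFlat) ∧ ∃ S : CPStructure g, ¬ S.IsFlat

end Structures

/-- A tuple such as `(0,0,0,12,13+14,24)`, in the notation for six-dimensional nilpotent Lie
algebras. Indices are shifted by one, to run over `Fin 6`: the entry at position `k` is the list of
the pairs `(i, j)` with `e^i ∧ e^j` a summand of `d e^k`, so that the tuple above is
`![[], [], [], [(0, 1)], [(0, 2), (0, 3)], [(1, 3)]]`. -/
abbrev Tuple : Type := Fin 6 → List (Fin 6 × Fin 6)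

/-- The value at `(x, y)` of the 2-form `∑ e^i ∧ e^j` (sum over the pairs in `l`), where `x` and `y`
are given by their coordinates. -/
def twoForm (l : List (Fin 6 × Fin 6)) (x y : Fin 6 → ℝ) : ℝ :=
  (l.map fun p => x p.1 * y p.2 - y p.1 * x p.2).sum

/-- `g` is the Lie algebra denoted by the tuple `t`: there is a basis of `g` whose dual basis
satisfies `d e^k = t k`, where `d f (x ∧ y) = -f [x, y]`. -/
def HasStructureEquations (g : Type*) [LieRing g] [LieAlgebra ℝ g] (t : Tuple) : Prop :=
  ∃ e : Module.Basis (Fin 6) ℝ g, ∀ (k : Fin 6) (x y : g),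
    -(e.coord k ⁅x, y⁆) = twoForm (t k) (fun i => e.coord i x) (fun i => e.coord i y)

/-- `(0,0,0,0,0,0)`, `(0,0,0,0,0,12)`, `(0,0,0,0,0,12+34)`, `(0,0,0,0,12,13)`,
`(0,0,0,0,13+42,14+23)`, `(0,0,0,0,12,14+23)`, `(0,0,0,0,12,34)`, `(0,0,0,12,13,23)`,
`(0,0,0,12,13,14+23)`. -/
def onlyFlatTuples : List Tuple :=
  [![[], [], [], [], [], []],
   ![[], [], [], [], [], [(0, 1)]],
   ![[], [], [], [], [], [(0, 1), (2, 3)]],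
   ![[], [], [], [], [(0, 1)], [(0, 2)]],
   ![[], [], [], [], [(0, 2), (3, 1)], [(0, 3), (1, 2)]],
   ![[], [], [], [], [(0, 1)], [(0, 3), (1, 2)]],
   ![[], [], [], [], [(0, 1)], [(2, 3)]],
   ![[], [], [], [(0, 1)], [(0, 2)], [(1, 2)]],
   ![[], [], [], [(0, 1)], [(0, 2)], [(0, 3), (1, 2)]]]

/-- `(0,0,0,12,14,24)` and `(0,0,0,12,13,24)`. -/
def onlyNonFlatTuples : List Tuple :=
  [![[], [], [], [(0, 1)], [(0, 3)], [(1, 3)]],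
   ![[], [], [], [(0, 1)], [(0, 2)], [(1, 3)]]]

/-- `(0,0,0,0,12,14+25)`, `(0,0,0,12,13,14)`, `(0,0,0,12,13+14,24)`, `(0,0,0,12,14,13+42)`. -/
def flatAndNonFlatTuples : List Tuple :=
  [![[], [], [], [], [(0, 1)], [(0, 3), (1, 4)]],
   ![[], [], [], [(0, 1)], [(0, 2)], [(0, 3)]],
   ![[], [], [], [(0, 1)], [(0, 2), (0, 3)], [(1, 3)]],
   ![[], [], [], [(0, 1)], [(0, 3)], [(0, 2), (3, 1)]]]

/-- The bracket on `ℝ⁶` encoded by a tuple. -/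
def tupleBracket (t : Tuple) (x y : Fin 6 → ℝ) : Fin 6 → ℝ := fun k => -twoForm (t k) x y

theorem twoForm_self (l : List (Fin 6 × Fin 6)) (x : Fin 6 → ℝ) : twoForm l x x = 0 := by
  simp [twoForm]

theorem twoForm_add_left (l : List (Fin 6 × Fin 6)) (x x' y : Fin 6 → ℝ) :
    twoForm l (x + x') y = twoForm l x y + twoForm l x' y := by
  induction l with
  | nil => simp [twoForm]
  | cons p l ih =>
    simp only [twoForm, List.map_cons, List.sum_cons, Pi.add_apply] at ih ⊢
    rw [ih]; ring

theorem twoForm_add_right (l : List (Fin 6 × Fin 6)) (x y y' : Fin 6 → ℝ) :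
    twoForm l x (y + y') = twoForm l x y + twoForm l x y' := by
  induction l with
  | nil => simp [twoForm]
  | cons p l ih =>
    simp only [twoForm, List.map_cons, List.sum_cons, Pi.add_apply] at ih ⊢
    rw [ih]; ring

theorem twoForm_smul_right (l : List (Fin 6 × Fin 6)) (c : ℝ) (x y : Fin 6 → ℝ) :
    twoForm l x (c • y) = c * twoForm l x y := by
  induction l with
  | nil => simp [twoForm]
  | cons p l ih =>
    simp only [twoForm, List.map_cons, List.sum_cons, Pi.smul_apply, smul_eq_mul] at ih ⊢
    rw [ih]; ring

/-- Every tuple in the three lists denotes a Lie algebra: the bracket it encodes on `ℝ⁶` satisfies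
the Jacobi identity. -/
theorem exists_hasStructureEquations :
    ∀ t ∈ onlyFlatTuples ++ onlyNonFlatTuples ++ flatAndNonFlatTuples,
      ∃ (g : Type) (_ : LieRing g) (_ : LieAlgebra ℝ g), HasStructureEquations g t := by
  intro t ht
  have jac : ∀ x y z : Fin 6 → ℝ, tupleBracket t x (tupleBracket t y z)
      = tupleBracket t (tupleBracket t x y) z + tupleBracket t y (tupleBracket t x z) := by
    intro x y z
    simp only [onlyFlatTuples, onlyNonFlatTuples, flatAndNonFlatTuples, List.cons_append,
      List.nil_append, List.mem_cons, List.not_mem_nil, or_false] at ht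
    rcases ht with rfl | rfl | rfl | rfl | rfl | rfl | rfl | rfl | rfl | rfl | rfl | rfl | rfl |
      rfl | rfl <;>
    · funext k
      fin_cases k <;> simp [tupleBracket, twoForm] <;> ring
  let L : LieRing (Fin 6 → ℝ) :=
    { bracket := tupleBracket t
      add_lie := fun x y z => by
        funext k; simp only [tupleBracket, twoForm_add_left, Pi.add_apply]; ring
      lie_add := fun x y z => by
        funext k; simp only [tupleBracket, twoForm_add_right, Pi.add_apply]; ring
      lie_self := fun x => by
        funext k; simp [tupleBracket, twoForm_self]
      leibniz_lie := jac }
  let A : LieAlgebra ℝ (Fin 6 → ℝ) :=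
    { lie_smul := fun c x y => by
        funext k
        change -twoForm (t k) x (c • y) = c * -twoForm (t k) x y
        rw [twoForm_smul_right]; ring }
  refine ⟨Fin 6 → ℝ, L, A, Pi.basisFun ℝ (Fin 6), fun k x y => ?_⟩
  change -(-twoForm (t k) x y) = twoForm (t k) x y
  rw [neg_neg]

end ComplexProduct

/-! Write `V = g₊` for the `+1` eigenspace of `E`, so that `g = V ⊕ JV`, and `∇`, `R` for the
connection and its curvature. Both commute with `J` and `E`, so everything is determined by
operators on `V`. The first Bianchi identity, split along `V ⊕ JV`, leaves only `R(x,Jy)z` with `x,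
y, z ∈ V`, and makes it totally symmetric. Hence flatness only has to be tested on `R(x,Jx)x`
(`isFlat_of_diagonal`).

All algebras of (i) but the last are two-step nilpotent. Put `A = ∇_x` and `B = ∇_{Jx}` on `V`. The
vanishing of double brackets gives `A² = B² = 0`, `AB = -BA` and `R(x,Jx)x = -3BAx`. If `BAx ≠ 0`,
then `x, Ax, Bx, BAx` are independent, as in an exterior algebra on two generators; but `dim V = 3`
(`isFlat_of_two_step`).

The last algebra of (i) and both algebras of (ii) carry a flag `0 ⊂ P ⊂ U ⊂ g`, with `P` and `U`
spanned by the last two and the last four basis vectors, such that `[g,g] ⊂ U`, `[g,U] ⊂ P`, `[g,P]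
= 0` and `[U,U] = 0`. Every integrable complex structure preserves `P`, and therefore `U`. Since
`{J, E}` contains a second complex structure mixing `J` and `JE`, the endomorphism `E` preserves the
flag too. So `∇` is strictly triangular in a frame of `V` adapted to the flag, and `R` reduces to
one number `m₀l₁ - m₁l₀ + n₃` (`IsTower.nonempty_towerFrame`). The structure equations force this
number to be zero for the algebra of (i) and non-zero for those of (ii).

Existence, and all of (iii), rests on explicit triples `(J, E, ∇)` in coordinates: a torsion-free
`∇` for which `J` and `E` are parallel yields both integrability conditions, and is the associated
connection by uniqueness. -/

namespace ComplexProduct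

/-! ### Curvature symmetries of a complex product structure -/

namespace CPStructure

variable {g : Type*} [LieRing g] [LieAlgebra ℝ g] (S : CPStructure g)

theorem explicitConnection_eq : S.explicitConnection = S.connection :=
  S.eq_connection S.explicitConnection_isAssociated

theorem connection_J (u v : g) : S.connection u (S.J v) = S.J (S.connection u v) :=
  S.connection_isAssociated.parallel_J u v

theorem connection_E (u v : g) : S.connection u (S.E v) = S.E (S.connection u v) :=
  S.connection_isAssociated.parallel_E u v

theorem connection_sub (u v : g) : S.connection u v - S.connection v u = ⁅u, v⁆ :=
  S.connection_isAssociated.torsionFree u v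

theorem E_J (u : g) : S.E (S.J u) = -S.J (S.E u) := by
  rw [S.anticomm, neg_neg]

theorem J_injective : Function.Injective S.J := fun u v h => by
  have := congrArg S.J h
  rwa [S.complex.sq, S.complex.sq, neg_inj] at this

theorem J_eq_zero {u : g} (h : S.J u = 0) : u = 0 :=
  S.J_injective (h.trans (map_zero _).symm)

variable {S} in
theorem E_connection_of_pos {u v : g} (h : S.E v = v) :
    S.E (S.connection u v) = S.connection u v := by
  rw [← connection_E, h]

variable {S} in
/-- The sum `g = g₊ ⊕ J g₊` is direct. -/
theorem eq_zero_of_add_J {x y : g} (hx : S.E x = x) (hy : S.E y = y) (h : x + S.J y = 0) :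
    x = 0 ∧ y = 0 := by
  have h1 := congrArg S.E h
  rw [map_add, S.E_J, hx, hy, map_zero] at h1
  have h2 : x = 0 := by linear_combination (norm := module) (1 / 2 : ℝ) • h + (1 / 2 : ℝ) • h1
  refine ⟨h2, S.J_eq_zero ?_⟩
  rwa [h2, zero_add] at h

theorem exists_pos_add_J (u : g) : ∃ x y, S.E x = x ∧ S.E y = y ∧ u = x + S.J y := by
  refine ⟨S.projPos u, -S.J (S.projNeg u), S.E_projPos u, ?_, ?_⟩
  · rw [map_neg, S.E_J, E_projNeg, map_neg, neg_neg]
  · rw [map_neg, S.complex.sq, neg_neg, projPos_add_projNeg]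

/-- The `+1` eigenspace of `E`. -/
noncomputable def posSpace : Submodule ℝ g := LinearMap.ker (S.E - LinearMap.id)

variable {S} in
theorem mem_posSpace {x : g} : x ∈ S.posSpace ↔ S.E x = x := by
  simp [posSpace, sub_eq_zero]

theorem two_mul_finrank_posSpace [Module.Finite ℝ g] :
    2 * Module.finrank ℝ S.posSpace = Module.finrank ℝ g := by
  let f : (S.posSpace × S.posSpace) →ₗ[ℝ] g :=
    LinearMap.coprod S.posSpace.subtype (S.J ∘ₗ S.posSpace.subtype)
  have hf : Function.Bijective f := by
    constructor
    · rw [injective_iff_map_eq_zero]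
      rintro ⟨⟨x, hx⟩, ⟨y, hy⟩⟩ h
      obtain ⟨h1, h2⟩ := eq_zero_of_add_J (mem_posSpace.1 hx) (mem_posSpace.1 hy)
        (by simpa [f] using h)
      simp [h1, h2]
    · intro u
      obtain ⟨x, y, hx, hy, h⟩ := S.exists_pos_add_J u
      exact ⟨⟨⟨x, mem_posSpace.2 hx⟩, ⟨y, mem_posSpace.2 hy⟩⟩, by simp [f, h]⟩
  rw [← (LinearEquiv.ofBijective f hf).finrank_eq, Module.finrank_prod, two_mul]

theorem curvature_J (u v w : g) : S.curvature u v (S.J w) = S.J (S.curvature u v w) := by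
  simp only [curvature, connection_J, map_sub]

theorem curvature_E (u v w : g) : S.curvature u v (S.E w) = S.E (S.curvature u v w) := by
  simp only [curvature, connection_E, map_sub]

theorem curvature_add_left (u u' v w : g) :
    S.curvature (u + u') v w = S.curvature u v w + S.curvature u' v w := by
  simp only [curvature, map_add, LinearMap.add_apply, add_lie]; abel

theorem curvature_add_middle (u v v' w : g) :
    S.curvature u (v + v') w = S.curvature u v w + S.curvature u v' w := by
  simp only [curvature, map_add, LinearMap.add_apply, lie_add]; abel

theorem curvature_add_right (u v w w' : g) :
    S.curvature u v (w + w') = S.curvature u v w + S.curvature u v w' := by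
  simp only [curvature, map_add]; abel

theorem curvature_swap (u v w : g) : S.curvature u v w = -S.curvature v u w := by
  simp only [curvature]
  rw [← lie_skew v u, map_neg, LinearMap.neg_apply]; abel

/-- The first Bianchi identity. -/
theorem curvature_cyclic (u v w : g) :
    S.curvature u v w + S.curvature v w u + S.curvature w u v = 0 := by
  have h : S.curvature u v w + S.curvature v w u + S.curvature w u v
      = ⁅u, ⁅v, w⁆⁆ + ⁅v, ⁅w, u⁆⁆ + ⁅w, ⁅u, v⁆⁆ := by
    have h1 : ∀ a b c : g, ⁅a, ⁅b, c⁆⁆ = S.connection a (S.connection b c)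
        - S.connection a (S.connection c b) - S.connection ⁅b, c⁆ a := fun a b c => by
      rw [← map_sub, S.connection_sub b c, S.connection_sub]
    rw [h1, h1, h1]
    simp only [curvature]
    abel
  rw [h, lie_jacobi]

variable {S} in
theorem E_curvature_of_pos {u v w : g} (h : S.E w = w) :
    S.E (S.curvature u v w) = S.curvature u v w := by
  rw [← curvature_E, h]

variable {S} in
-- In the Bianchi identity for `x, y, J z` the term `R(x,y)Jz = J R(x,y)z` lies in `J g₊` and the
-- other two lie in `g₊`, so the two parts vanish separately.
theorem curvature_pos_pos {x y z : g} (hx : S.E x = x) (hy : S.E y = y) (hz : S.E z = z) :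
    S.curvature x y z = 0 ∧ S.curvature x (S.J z) y = S.curvature y (S.J z) x := by
  have h := S.curvature_cyclic x y (S.J z)
  rw [curvature_J, S.curvature_swap (S.J z) x y] at h
  obtain ⟨h1, h2⟩ := eq_zero_of_add_J
    (x := S.curvature y (S.J z) x - S.curvature x (S.J z) y) (y := S.curvature x y z)
    (by rw [map_sub, E_curvature_of_pos hx, E_curvature_of_pos hy])
    (E_curvature_of_pos hz) (by rw [← h]; abel)
  exact ⟨h2, (sub_eq_zero.1 h1).symm⟩

variable {S} in
-- Same splitting of the Bianchi identity, for `z, J x, J y`: here `R(Jx,Jy)z` is the only term in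
-- `g₊`. Together with `curvature_pos_pos` this makes `R(x,Jy)z` symmetric in all three arguments.
theorem curvature_neg_neg {x y z : g} (hx : S.E x = x) (hy : S.E y = y) (hz : S.E z = z) :
    S.curvature (S.J x) (S.J y) z = 0 ∧
      S.curvature z (S.J x) y = S.curvature z (S.J y) x := by
  have h := S.curvature_cyclic z (S.J x) (S.J y)
  rw [curvature_J, S.curvature_swap (S.J y) z, curvature_J] at h
  obtain ⟨h1, h2⟩ := eq_zero_of_add_J
    (x := S.curvature (S.J x) (S.J y) z) (y := S.curvature z (S.J x) y - S.curvature z (S.J y) x)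
    (E_curvature_of_pos hz)
    (by rw [map_sub, E_curvature_of_pos hx, E_curvature_of_pos hy])
    (by rw [← h, map_sub]; abel)
  exact ⟨h1, sub_eq_zero.1 h2⟩

variable {S} in
theorem isFlat_of_mixed
    (h : ∀ x y z, S.E x = x → S.E y = y → S.E z = z → S.curvature x (S.J y) z = 0) :
    S.IsFlat := by
  have key : ∀ u v z, S.E z = z → S.curvature u v z = 0 := by
    intro u v z hz
    obtain ⟨x, y, hx, hy, rfl⟩ := S.exists_pos_add_J u
    obtain ⟨x', y', hx', hy', rfl⟩ := S.exists_pos_add_J v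
    rw [curvature_add_left, curvature_add_middle, curvature_add_middle, h x y' z hx hy' hz,
      (curvature_pos_pos hx hx' hz).1, (curvature_neg_neg hy hy' hz).1,
      S.curvature_swap (S.J y), h x' y z hx' hy hz]
    simp
  intro u v w
  obtain ⟨x, y, hx, hy, rfl⟩ := S.exists_pos_add_J w
  rw [curvature_add_right, curvature_J, key u v x hx, key u v y hy]
  simp

variable {S} in
/-- The mixed part of the curvature is a symmetric trilinear map, so it is determined by its
restriction to the diagonal. -/
theorem isFlat_of_diagonal (h : ∀ x, S.E x = x → S.curvature x (S.J x) x = 0) : S.IsFlat := by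
  have hadd : ∀ {x y : g}, S.E x = x → S.E y = y → S.E (x + y) = x + y := fun hx hy => by
    rw [map_add, hx, hy]
  have hneg : ∀ {x : g}, S.E x = x → S.E (-x) = -x := fun hx => by rw [map_neg, hx]
  have hn : ∀ x y z : g, S.curvature (-x) y z = -S.curvature x y z := fun x y z => by
    simp only [curvature, map_neg, LinearMap.neg_apply, neg_lie]; abel
  have hn' : ∀ x y z : g, S.curvature x (-y) z = -S.curvature x y z := fun x y z => by
    simp only [curvature, map_neg, LinearMap.neg_apply, lie_neg]; abel
  have hn'' : ∀ x y z : g, S.curvature x y (-z) = -S.curvature x y z := fun x y z => by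
    simp only [curvature, map_neg]; abel
  -- Polarization of the cubic form `T(x) = R(x,Jx)x`: `T(x+y) - T(x-y) = 6T(x,x,y) + 2T(y)`. The
  -- second polarization below uses `T(x+y,x+y,z)`.
  have h2 : ∀ x y, S.E x = x → S.E y = y → S.curvature x (S.J x) y = 0 := by
    intro x y hx hy
    have a1 := h (x + y) (hadd hx hy)
    have a2 := h (x + -y) (hadd hx (hneg hy))
    have a3 := h y hy
    have b1 := (curvature_neg_neg hx hy hx).2
    have b2 := (curvature_pos_pos hx hy hx).2
    simp only [map_add, map_neg, curvature_add_left, curvature_add_middle, curvature_add_right,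
      hn, hn', hn''] at a1 a2
    have h6 : (6 : ℝ) • S.curvature x (S.J x) y = 0 := by
      linear_combination (norm := module) a1 - a2 - (2 : ℝ) • a3 + (2 : ℝ) • b1 + (2 : ℝ) • b2
    exact (smul_eq_zero.1 h6).resolve_left (by norm_num)
  refine isFlat_of_mixed fun x y z hx hy hz => ?_
  have a1 := h2 (x + y) z (hadd hx hy) hz
  have a2 := h2 x z hx hz
  have a3 := h2 y z hy hz
  have b2 := (curvature_pos_pos hy hz hx).2
  have b3 := (curvature_neg_neg hx hy hz).2
  have b4 := (curvature_pos_pos hx hz hy).2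
  simp only [map_add, curvature_add_left, curvature_add_middle] at a1
  have h6 : (2 : ℝ) • S.curvature x (S.J y) z = 0 := by
    linear_combination (norm := module) a1 - a2 - a3 - b2 - b3 + b4
  exact (smul_eq_zero.1 h6).resolve_left (by norm_num)

end CPStructure

end ComplexProduct

/-! ### Two-step nilpotent algebras in dimension six -/

namespace ComplexProduct

namespace CPStructure

variable {g : Type*} [LieRing g] [LieAlgebra ℝ g] {S : CPStructure g}

/-- For `x, y` in `g₊` this is the splitting of the bracket along `J g₊ ⊕ g₊`, which turns double
brackets into pairs of identities for the connection. -/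
theorem lie_pos_neg (x y : g) :
    ⁅x, S.J y⁆ = S.J (S.connection x y) - S.connection (S.J y) x := by
  rw [← S.connection_sub, connection_J]

/-- The identities in a two-step nilpotent Lie algebra obtained from `⁅z, ⁅x, J y⁆⁆ = 0`. -/
theorem two_step_pos (h : ∀ x y z : g, ⁅x, ⁅y, z⁆⁆ = 0) {x y z : g}
    (hx : S.E x = x) (hy : S.E y = y) (hz : S.E z = z) :
    S.connection z (S.connection x y) = 0 ∧
      S.connection (S.J (S.connection x y)) z + S.connection z (S.connection (S.J y) x)
        - S.connection (S.connection (S.J y) x) z = 0 := by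
  have h1 := h z x (S.J y)
  rw [lie_pos_neg, lie_sub, lie_pos_neg, ← S.connection_sub z] at h1
  obtain ⟨h2, h3⟩ := eq_zero_of_add_J (S := S)
    (x := -(S.connection (S.J (S.connection x y)) z + S.connection z (S.connection (S.J y) x)
        - S.connection (S.connection (S.J y) x) z))
    (y := S.connection z (S.connection x y))
    (by simp only [map_neg, map_add, map_sub, E_connection_of_pos hz,
          E_connection_of_pos (E_connection_of_pos hx)])
    (E_connection_of_pos (E_connection_of_pos hy))
    (by rw [← h1]; abel)
  exact ⟨h3, neg_eq_zero.1 h2⟩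

/-- The identities in a two-step nilpotent Lie algebra obtained from `⁅J z, ⁅x, J y⁆⁆ = 0`. -/
theorem two_step_neg (h : ∀ x y z : g, ⁅x, ⁅y, z⁆⁆ = 0) {x y z : g}
    (hx : S.E x = x) (hy : S.E y = y) (hz : S.E z = z) :
    S.connection (S.J z) (S.connection (S.J y) x) = 0 ∧
      S.connection (S.J z) (S.connection x y) - S.connection (S.J (S.connection x y)) z
        + S.connection (S.connection (S.J y) x) z = 0 := by
  have h1 := h (S.J z) x (S.J y)
  rw [lie_pos_neg, lie_sub, ← S.connection_sub (S.J z), ← S.connection_sub (S.J z), connection_J,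
    connection_J, connection_J] at h1
  obtain ⟨h2, h3⟩ := eq_zero_of_add_J (S := S)
    (x := -S.connection (S.J z) (S.connection (S.J y) x))
    (y := S.connection (S.J z) (S.connection x y) - S.connection (S.J (S.connection x y)) z
        + S.connection (S.connection (S.J y) x) z)
    (by rw [map_neg, E_connection_of_pos (E_connection_of_pos hx)])
    (by simp only [map_add, map_sub, E_connection_of_pos hz,
          E_connection_of_pos (E_connection_of_pos hy)])
    (by rw [← h1, map_add, map_sub]; abel)
  exact ⟨neg_eq_zero.1 h2, h3⟩

/-- The `g₊` component of `[[x,y], Jz] = 0` is `-∇_{Jz}[x,y]`, and `[x,y] = ∇_x y - ∇_y x`. -/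
theorem two_step_connection_symm (h : ∀ x y z : g, ⁅x, ⁅y, z⁆⁆ = 0) {x y z : g}
    (hx : S.E x = x) (hy : S.E y = y) (hz : S.E z = z) :
    S.connection (S.J z) (S.connection x y) = S.connection (S.J z) (S.connection y x) := by
  have h1 : ⁅⁅x, y⁆, S.J z⁆ = 0 := by rw [← lie_skew, h, neg_zero]
  rw [lie_pos_neg, ← S.connection_sub x] at h1
  obtain ⟨h2, -⟩ := eq_zero_of_add_J (S := S)
    (x := -S.connection (S.J z) (S.connection x y - S.connection y x))
    (y := S.connection (S.connection x y - S.connection y x) z)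
    (by rw [map_neg, E_connection_of_pos]
        rw [map_sub, E_connection_of_pos hx, E_connection_of_pos hy])
    (E_connection_of_pos hz) (by rw [← h1]; abel)
  rwa [neg_eq_zero, map_sub, sub_eq_zero] at h2

/-- Complex product structures on six-dimensional two-step nilpotent Lie algebras are flat. -/
theorem isFlat_of_two_step (h : ∀ x y z : g, ⁅x, ⁅y, z⁆⁆ = 0) (hg : Module.finrank ℝ g = 6) :
    S.IsFlat := by
  have : Module.Finite ℝ g := Module.finite_of_finrank_eq_succ hg
  have hV : Module.finrank ℝ S.posSpace = 3 := by
    have := S.two_mul_finrank_posSpace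
    omega
  refine isFlat_of_diagonal fun x hx => ?_
  set A := S.connection x with hA
  set B := S.connection (S.J x) with hB
  have hAA : ∀ u, S.E u = u → A (A u) = 0 := fun u hu => (two_step_pos h hx hu hx).1
  have hBB : ∀ u, S.E u = u → B (B u) = 0 := fun u hu => (two_step_neg h hu hx hx).1
  -- Adding the two mixed identities cancels the terms `∇_{J∇_u x} x` and `∇_{∇_{Jx} u} x` and
  -- leaves `ABu + B∇_u x = 0`; then `B∇_u x = BAu` by symmetry.
  have hAB : ∀ u, S.E u = u → A (B u) = -B (A u) := fun u hu => by
    have h1 := (two_step_pos h hu hx hx).2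
    have h2 := (two_step_neg h hu hx hx).2
    rw [two_step_connection_symm h hu hx hx] at h2
    linear_combination (norm := (simp only [hA, hB]; module)) h1 + h2
  -- Here `[x,Jx] = J(Ax) - Bx`, and the second mixed identity gives `∇_{[x,Jx]} x = BAx`; so the
  -- curvature is `ABx - 2BAx`.
  have hR : S.curvature x (S.J x) x = (-3 : ℝ) • B (A x) := by
    have h1 := (two_step_neg h hx hx hx).2
    have h2 := hAB x hx
    simp only [curvature, lie_pos_neg, map_sub, LinearMap.sub_apply]
    linear_combination (norm := (simp only [hA, hB]; module)) h1 + h2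
  rw [hR, smul_eq_zero]
  right
  by_contra hne
  have hAx : S.E (A x) = A x := E_connection_of_pos hx
  have hBx : S.E (B x) = B x := E_connection_of_pos hx
  have hBAx : S.E (B (A x)) = B (A x) := E_connection_of_pos hAx
  let v : Fin 4 → S.posSpace := ![⟨x, mem_posSpace.2 hx⟩, ⟨A x, mem_posSpace.2 hAx⟩,
    ⟨B (A x), mem_posSpace.2 hBAx⟩, ⟨B x, mem_posSpace.2 hBx⟩]
  -- Applying `A` kills `A x` and `B (A x)`; applying `B` after it isolates the coefficient of `x`.
  -- The other coefficients follow by the same elimination.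
  have hv : LinearIndependent ℝ v := by
    rw [Fintype.linearIndependent_iff]
    intro c hc
    have e0 : c 0 • x + c 1 • A x + c 2 • B (A x) + c 3 • B x = 0 := by
      have := congrArg Subtype.val hc
      simpa [Fin.sum_univ_four, v] using this
    have hABA : A (B (A x)) = 0 := by rw [hAB _ hAx, hAA x hx, map_zero, neg_zero]
    have e1 := congrArg A e0
    simp only [map_add, map_smul, map_zero, hAA x hx, hABA, hAB x hx, smul_zero, add_zero] at e1
    have e2 := congrArg B e1
    simp only [map_add, map_smul, map_neg, map_zero, hBB _ hAx, smul_zero, add_zero, neg_zero,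
      smul_eq_zero, hne, or_false] at e2
    simp only [e2, zero_smul, zero_add, smul_neg, neg_eq_zero, smul_eq_zero, hne, or_false] at e1
    simp only [e1, e2, zero_smul, zero_add, add_zero] at e0
    have e3 := congrArg B e0
    simp only [map_add, map_smul, map_zero, hBB _ hAx, smul_zero, add_zero, smul_eq_zero, hne,
      or_false] at e3
    simp only [e3, zero_smul, zero_add, smul_eq_zero, hne, or_false] at e0
    intro i
    fin_cases i <;> assumption
  have := hv.fintype_card_le_finrank
  rw [hV] at this
  simp at this

end CPStructure

end ComplexProduct

/-! ### The flag of a tower algebra, stable subspaces and adapted frames -/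

namespace ComplexProduct

section Coordinates

variable {g : Type*} [LieRing g] [LieAlgebra ℝ g]

/-- The span of the last four vectors of a basis `e 0, …, e 5`. -/
noncomputable def lastFour (e : Module.Basis (Fin 6) ℝ g) : Submodule ℝ g :=
  LinearMap.ker (e.coord 0) ⊓ LinearMap.ker (e.coord 1)

/-- The span of the last two vectors of a basis `e 0, …, e 5`. -/
noncomputable def lastTwo (e : Module.Basis (Fin 6) ℝ g) : Submodule ℝ g :=
  lastFour e ⊓ (LinearMap.ker (e.coord 2) ⊓ LinearMap.ker (e.coord 3))

variable {e : Module.Basis (Fin 6) ℝ g}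

theorem mem_lastFour {x : g} : x ∈ lastFour e ↔ e.coord 0 x = 0 ∧ e.coord 1 x = 0 := by
  simp [lastFour]

theorem mem_lastTwo {x : g} : x ∈ lastTwo e ↔
    e.coord 0 x = 0 ∧ e.coord 1 x = 0 ∧ e.coord 2 x = 0 ∧ e.coord 3 x = 0 := by
  simp [lastTwo, lastFour, and_assoc]

theorem lastTwo_le_lastFour : lastTwo e ≤ lastFour e := inf_le_left

theorem eq_of_coord_eq {x y : g} (h : ∀ i, e.coord i x = e.coord i y) : x = y :=
  e.ext_elem h

theorem coord_basis (i j : Fin 6) : e.coord i (e j) = if j = i then 1 else 0 := by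
  rw [Module.Basis.coord_apply, Module.Basis.repr_self, Finsupp.single_apply]

theorem eq_combination_of_mem_lastTwo {x : g} (hx : x ∈ lastTwo e) :
    x = e.coord 4 x • e 4 + e.coord 5 x • e 5 := by
  obtain ⟨h0, h1, h2, h3⟩ := mem_lastTwo.1 hx
  refine eq_of_coord_eq (e := e) fun i => ?_
  fin_cases i <;> simp [-Module.Basis.coord_apply, coord_basis, h0, h1, h2, h3]

theorem basis_mem_lastTwo : e 4 ∈ lastTwo e ∧ e 5 ∈ lastTwo e := by
  constructor <;> simp [mem_lastTwo, -Module.Basis.coord_apply, coord_basis]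

theorem basis_mem_lastFour : e 2 ∈ lastFour e ∧ e 3 ∈ lastFour e := by
  constructor <;> simp [mem_lastFour, -Module.Basis.coord_apply, coord_basis]

variable (e) in
/-- The structure of the nilpotent Lie algebras `(0,0,0,12,a,b)` in which `e 4`, `e 5` are central
and the last four vectors of the basis commute. -/
structure IsTower : Prop where
  coord_zero : ∀ x y : g, e.coord 0 ⁅x, y⁆ = 0
  coord_one : ∀ x y : g, e.coord 1 ⁅x, y⁆ = 0
  coord_two : ∀ x y : g, e.coord 2 ⁅x, y⁆ = 0
  coord_three : ∀ x y : g, e.coord 3 ⁅x, y⁆ =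
    -(e.coord 0 x * e.coord 1 y - e.coord 0 y * e.coord 1 x)
  abelian : ∀ x ∈ lastFour e, ∀ y ∈ lastFour e, ⁅x, y⁆ = 0
  central : ∀ x ∈ lastTwo e, ∀ y : g, ⁅x, y⁆ = 0
  lie_zero_one : ⁅e 0, e 1⁆ = -e 3

namespace IsTower

theorem lie_mem_lastFour (h : IsTower e) (x y : g) : ⁅x, y⁆ ∈ lastFour e :=
  mem_lastFour.2 ⟨h.coord_zero x y, h.coord_one x y⟩

theorem lie_mem_lastTwo (h : IsTower e) (x : g) {y : g} (hy : y ∈ lastFour e) : ⁅x, y⁆ ∈ lastTwo e := by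
  obtain ⟨h0, h1⟩ := mem_lastFour.1 hy
  refine mem_lastTwo.2 ⟨h.coord_zero x y, h.coord_one x y, h.coord_two x y, ?_⟩
  rw [h.coord_three, h0, h1]; ring

end IsTower

/-- In a subspace stable under `J`, the combinations of `x` and `J x` are independent of it. -/
theorem IsComplexStructure.eq_zero_of_mem {J : g →ₗ[ℝ] g} (hJ : IsComplexStructure J)
    {P : Submodule ℝ g} (hP : ∀ x ∈ P, J x ∈ P) {x : g} (hx : x ∉ P) {a b : ℝ}
    (hab : a • x + b • J x ∈ P) : a = 0 ∧ b = 0 := by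
  have h1 := hP _ hab
  rw [map_add, map_smul, map_smul, hJ.sq] at h1
  -- This is `a(ax + bJx) - bJ(ax + bJx)`, by `J² = -Id`.
  have h2 : (a * a + b * b) • x ∈ P := by
    have h3 := P.sub_mem (P.smul_mem a hab) (P.smul_mem b h1)
    convert h3 using 1
    module
  by_contra hne
  refine hx ((P.smul_mem_iff ?_).1 h2)
  intro h0
  exact hne ⟨by nlinarith [mul_self_nonneg a, mul_self_nonneg b],
    by nlinarith [mul_self_nonneg a, mul_self_nonneg b]⟩

/-- If a central plane contains `p ≠ 0` and `J p`, then it is stable under `J`. -/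
theorem IsComplexStructure.map_lastTwo_of_exists {J : g →ₗ[ℝ] g} (hJ : IsComplexStructure J)
    (h : ∃ p ∈ lastTwo e, p ≠ 0 ∧ J p ∈ lastTwo e) : ∀ x ∈ lastTwo e, J x ∈ lastTwo e := by
  obtain ⟨p, hp, hp0, hJp⟩ := h
  have e1 := eq_combination_of_mem_lastTwo hp
  have e2 := eq_combination_of_mem_lastTwo hJp
  set a := e.coord 4 p
  set b := e.coord 5 p
  set c := e.coord 4 (J p)
  set d := e.coord 5 (J p)
  -- A real dependence between `p` and `J p` would contradict `J² = -Id`, which is the case of the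
  -- zero subspace. So `p, J p` span the plane, and Cramer's rule expresses `e 4` and `e 5` through
  -- them.
  have hdet : a * d - b * c ≠ 0 := by
    intro h0
    have hz : ∀ x ∈ (⊥ : Submodule ℝ g), J x ∈ (⊥ : Submodule ℝ g) := by simp
    have h1 : d • p + (-b) • J p ∈ (⊥ : Submodule ℝ g) := by
      rw [Submodule.mem_bot, e2]; nth_rewrite 1 [e1]
      linear_combination (norm := module) h0 • e 4
    have h2 : (-c) • p + a • J p ∈ (⊥ : Submodule ℝ g) := by
      rw [Submodule.mem_bot, e2]; nth_rewrite 1 [e1]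
      linear_combination (norm := module) h0 • e 5
    have h3 := hJ.eq_zero_of_mem hz (by simpa using hp0) h1
    have h4 := hJ.eq_zero_of_mem hz (by simpa using hp0) h2
    apply hp0
    rw [e1, h4.2, neg_eq_zero.1 h3.2]; simp
  have key : ∀ x y : g, (a * d - b * c) • x = y → y ∈ Submodule.span ℝ {p, J p} →
      J x ∈ lastTwo e := by
    intro x y hxy hy
    obtain ⟨s, t, hst⟩ := Submodule.mem_span_pair.1 hy
    refine ((lastTwo e).smul_mem_iff hdet).1 ?_
    rw [← map_smul, hxy, ← hst, map_add, map_smul, map_smul, hJ.sq]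
    exact (lastTwo e).add_mem ((lastTwo e).smul_mem _ hJp)
      ((lastTwo e).smul_mem _ ((lastTwo e).neg_mem hp))
  have k4 : J (e 4) ∈ lastTwo e := key _ (d • p + (-b) • J p)
    (by rw [e2]; nth_rewrite 1 [e1]; module) (Submodule.mem_span_pair.2 ⟨_, _, rfl⟩)
  have k5 : J (e 5) ∈ lastTwo e := key _ ((-c) • p + a • J p)
    (by rw [e2]; nth_rewrite 1 [e1]; module) (Submodule.mem_span_pair.2 ⟨_, _, rfl⟩)
  intro x hx
  rw [eq_combination_of_mem_lastTwo hx, map_add, map_smul, map_smul]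
  exact (lastTwo e).add_mem ((lastTwo e).smul_mem _ k4) ((lastTwo e).smul_mem _ k5)

/-- Modulo `P`, integrability for `e 3` and `y` reads `[Je₃,y] + J[Je₃,Jy] ≡ 0`, and brackets are
multiples of `e 3` modulo `P`, up to terms that `J` keeps in `P`. So `[Je₃,y]` lies in `P` for all
`y`, which puts `J (e 3)` in `U`. It must involve `e 2`, since `e 3` cannot span a real eigenline
modulo `P`; this brings `J (e 2)` into `U`. -/
theorem IsTower.map_lastFour (h : IsTower e) {J : g →ₗ[ℝ] g} (hJ : IsComplexStructure J)
    (hP : ∀ x ∈ lastTwo e, J x ∈ lastTwo e) : ∀ x ∈ lastFour e, J x ∈ lastFour e := by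
  have h3 : e 3 ∉ lastTwo e := by
    simp [mem_lastTwo, -Module.Basis.coord_apply, coord_basis]
  have hf : ∀ y, e.coord 3 ⁅J (e 3), y⁆ = 0 := by
    have hmod : ∀ y, ⁅J (e 3), y⁆ - e.coord 3 ⁅J (e 3), y⁆ • e 3 ∈ lastTwo e := fun y => by
      simp [mem_lastTwo, -Module.Basis.coord_apply, coord_basis, h.coord_zero, h.coord_one,
        h.coord_two]
    intro y
    have h1 := hJ.integrable (e 3) y
    have hl : ∀ y, ⁅e 3, y⁆ ∈ lastTwo e := fun y => by
      rw [← lie_skew]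
      exact (lastTwo e).neg_mem (h.lie_mem_lastTwo _ basis_mem_lastFour.2)
    refine (hJ.eq_zero_of_mem hP h3 (b := e.coord 3 ⁅J (e 3), J y⁆) ?_).1
    have h2 := (lastTwo e).sub_mem ((lastTwo e).sub_mem ((lastTwo e).sub_mem (hP _ (hl y))
      (hl (J y))) (hmod y)) (hP _ (hmod (J y)))
    convert h2 using 1
    rw [h1, map_sub, map_smul]
    abel
  have hw0 : e.coord 0 (J (e 3)) = 0 := by
    have := hf (e 1)
    rw [h.coord_three] at this
    simpa [-Module.Basis.coord_apply, coord_basis] using this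
  have hw1 : e.coord 1 (J (e 3)) = 0 := by
    have := hf (e 0)
    rw [h.coord_three] at this
    simpa [-Module.Basis.coord_apply, coord_basis] using this
  have hJ3 : J (e 3) ∈ lastFour e := mem_lastFour.2 ⟨hw0, hw1⟩
  set c := e.coord 2 (J (e 3)) with hc
  set d := e.coord 3 (J (e 3)) with hd
  have hr : J (e 3) - c • e 2 - d • e 3 ∈ lastTwo e := by
    simp [mem_lastTwo, -Module.Basis.coord_apply, coord_basis, hw0, hw1, ← hc, ← hd]
  have hc0 : c ≠ 0 := by
    intro h0
    rw [h0, zero_smul, sub_zero] at hr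
    have := hJ.eq_zero_of_mem hP h3 (a := -d) (b := 1) (by convert hr using 1; module)
    exact one_ne_zero this.2
  have hJ2 : J (e 2) ∈ lastFour e := by
    refine ((lastFour e).smul_mem_iff hc0).1 ?_
    have h1 := lastTwo_le_lastFour (hP _ hr)
    rw [map_sub, map_sub, map_smul, map_smul, hJ.sq] at h1
    have h2 := (lastFour e).sub_mem ((lastFour e).sub_mem
      ((lastFour e).neg_mem basis_mem_lastFour.2) ((lastFour e).smul_mem d hJ3)) h1
    convert h2 using 1
    abel
  intro x hx
  obtain ⟨h0, h1⟩ := mem_lastFour.1 hx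
  have hx' : x - e.coord 2 x • e 2 - e.coord 3 x • e 3 ∈ lastTwo e := by
    simp [mem_lastTwo, -Module.Basis.coord_apply, coord_basis, h0, h1]
  have h2 := lastTwo_le_lastFour (hP _ hx')
  rw [map_sub, map_sub, map_smul, map_smul] at h2
  have h4 := (lastFour e).add_mem ((lastFour e).add_mem h2 ((lastFour e).smul_mem (e.coord 3 x) hJ3))
    ((lastFour e).smul_mem (e.coord 2 x) hJ2)
  convert h4 using 1
  abel

namespace CPStructure

variable (S : CPStructure g)

/-- A second complex structure in the family spanned by `J` and `JE`. -/
noncomputable def rotatedJ : g →ₗ[ℝ] g := (5 / 4 : ℝ) • S.J + (3 / 4 : ℝ) • (S.J ∘ₗ S.E)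

theorem rotatedJ_apply (x : g) : S.rotatedJ x = (5 / 4 : ℝ) • S.J x + (3 / 4 : ℝ) • S.J (S.E x) :=
  rfl

/-- Since `J` and `JE` anticommute with squares `-Id` and `Id`, the square is `-((5/4)² - (3/4)²) =
-1`. Integrability holds because the endomorphism is parallel for a torsion-free connection. -/
theorem rotatedJ_isComplexStructure : IsComplexStructure S.rotatedJ := by
  have hsq : ∀ x, S.rotatedJ (S.rotatedJ x) = -x := fun x => by
    simp only [rotatedJ_apply, map_add, map_smul, S.E_J, S.complex.sq, S.product.sq, map_neg]
    module
  have hpar : ∀ u v, S.connection u (S.rotatedJ v) = S.rotatedJ (S.connection u v) :=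
    fun u v => by simp only [rotatedJ_apply, map_add, map_smul, connection_J, connection_E]
  refine ⟨hsq, fun x y => ?_⟩
  simp only [← S.connection_sub, map_sub, hpar, hsq]
  abel

/-- A subspace is stable if it is preserved by `J` and `E`. -/
def IsStable (A : Submodule ℝ g) : Prop := (∀ x ∈ A, S.J x ∈ A) ∧ ∀ x ∈ A, S.E x ∈ A

/-- A subspace preserved by both `J` and `rotatedJ` is preserved by `JE`, hence by `E`. -/
theorem isStable_of_forall {A : Submodule ℝ g}
    (h : ∀ J : g →ₗ[ℝ] g, IsComplexStructure J → ∀ x ∈ A, J x ∈ A) : S.IsStable A := by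
  have h1 := h _ S.complex
  refine ⟨h1, fun x hx => ?_⟩
  have h2 := h _ S.rotatedJ_isComplexStructure x hx
  rw [rotatedJ_apply] at h2
  have h3 := (A.smul_mem_iff (by norm_num : (3 / 4 : ℝ) ≠ 0)).1
    ((A.add_mem_iff_right (A.smul_mem _ (h1 x hx))).1 h2)
  have h4 := A.neg_mem (h1 _ h3)
  rwa [S.complex.sq, neg_neg] at h4

variable {S}

theorem IsStable.projPos_mem {A : Submodule ℝ g} (hA : S.IsStable A) {x : g} (hx : x ∈ A) :
    S.projPos x ∈ A := A.smul_mem _ (A.add_mem hx (hA.2 x hx))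

theorem IsStable.projNeg_mem {A : Submodule ℝ g} (hA : S.IsStable A) {x : g} (hx : x ∈ A) :
    S.projNeg x ∈ A := A.smul_mem _ (A.sub_mem hx (hA.2 x hx))

/-- The explicit formula for the connection involves only brackets of projections, followed by `J`
and projections, so inclusions between brackets of stable subspaces carry over to it. -/
theorem IsStable.connection_mem {A B C : Submodule ℝ g} (hA : S.IsStable A) (hB : S.IsStable B)
    (hC : S.IsStable C) (h : ∀ x ∈ C, ∀ y ∈ B, ⁅x, y⁆ ∈ A) {x y : g} (hx : x ∈ C) (hy : y ∈ B) :
    S.connection x y ∈ A ∧ S.connection y x ∈ A := by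
  have h1 : S.connection x y ∈ A := by
    rw [← S.explicitConnection_eq, explicitConnection_apply]
    refine A.add_mem (A.add_mem (A.sub_mem (A.neg_mem ?_) ?_) ?_) ?_
    · exact hA.projPos_mem (hA.1 _ (h _ (hC.projPos_mem hx) _ (hB.1 _ (hB.projPos_mem hy))))
    · exact hA.projNeg_mem (hA.1 _ (h _ (hC.projNeg_mem hx) _ (hB.1 _ (hB.projNeg_mem hy))))
    · exact hA.projNeg_mem (h _ (hC.projPos_mem hx) _ (hB.projNeg_mem hy))
    · exact hA.projPos_mem (h _ (hC.projNeg_mem hx) _ (hB.projPos_mem hy))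
  refine ⟨h1, ?_⟩
  have h2 := A.sub_mem h1 (h x hx y hy)
  rwa [← S.connection_sub x y, sub_sub_cancel] at h2

theorem IsStable.eq_zero_of_mem {B : Submodule ℝ g} (hB : S.IsStable B) {v : g}
    (hvB : v ∉ B) {a b : ℝ} (h : a • v + b • S.J v ∈ B) : a = 0 ∧ b = 0 :=
  S.complex.eq_zero_of_mem hB.1 hvB h

/-- A stable subspace of codimension two in another one has a complement spanned by `v` and `J v`,
for some `v` in `g₊`. -/
theorem IsStable.exists_frame {B C : Submodule ℝ g} (hB : S.IsStable B) (hC : S.IsStable C)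
    {p q : g} (hp : p ∈ C) (hpB : p ∉ B) (hpq : ∀ c ∈ C, ∃ a b : ℝ, c - a • p - b • q ∈ B) :
    ∃ v ∈ C, S.E v = v ∧ v ∉ B ∧ ∀ c ∈ C, ∃ a b : ℝ, c - (a • v + b • S.J v) ∈ B := by
  -- One of the two eigencomponents of `p` lies outside `B`; if it is the `-1` component, `J` moves
  -- it into `g₊`.
  obtain ⟨v, hvC, hv, hvB⟩ : ∃ v ∈ C, S.E v = v ∧ v ∉ B := by
    by_cases h1 : S.projPos p ∈ B
    · refine ⟨S.J (S.projNeg p), hC.1 _ (hC.projNeg_mem hp), ?_, fun h2 => hpB ?_⟩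
      · rw [S.E_J, E_projNeg, map_neg, neg_neg]
      · have h3 := B.neg_mem (hB.1 _ h2)
        rw [S.complex.sq, neg_neg] at h3
        rw [← S.projPos_add_projNeg p]
        exact B.add_mem h1 h3
    · exact ⟨_, hC.projPos_mem hp, S.E_projPos p, h1⟩
  refine ⟨v, hvC, hv, hvB, ?_⟩
  obtain ⟨a, b, hab⟩ := hpq v hvC
  obtain ⟨c, d, hcd⟩ := hpq (S.J v) (hC.1 v hvC)
  have hdet : a * d - b * c ≠ 0 := by
    intro h0
    have h1 := B.sub_mem (B.smul_mem d hab) (B.smul_mem b hcd)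
    have h2 := B.sub_mem (B.smul_mem a hcd) (B.smul_mem c hab)
    have h1' : d • v + (-b) • S.J v ∈ B := by
      convert h1 using 1
      linear_combination (norm := module) h0 • p
    have h2' : (-c) • v + a • S.J v ∈ B := by
      convert h2 using 1
      linear_combination (norm := module) h0 • q
    have h3 := hB.eq_zero_of_mem hvB h1'
    have h4 := hB.eq_zero_of_mem hvB h2'
    rw [h4.2, neg_eq_zero.1 h3.2] at hab
    exact hvB (by simpa using hab)
  intro x hx
  obtain ⟨s, t, hst⟩ := hpq x hx
  -- Cramer's rule for the change from `p, q` to `v, J v` modulo `B`.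
  refine ⟨(a * d - b * c)⁻¹ * (s * d - t * c), (a * d - b * c)⁻¹ * (t * a - s * b),
    (B.smul_mem_iff hdet).1 ?_⟩
  have h1 := B.sub_mem (B.sub_mem (B.smul_mem (a * d - b * c) hst)
    (B.smul_mem (s * d - t * c) hab)) (B.smul_mem (t * a - s * b) hcd)
  convert h1 using 1
  rw [smul_sub, smul_add, smul_smul, smul_smul, ← mul_assoc, ← mul_assoc, mul_inv_cancel₀ hdet]
  module

end CPStructure

end Coordinates

end ComplexProduct

/-! ### Normal form of the connection on a tower algebra -/

namespace ComplexProduct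

variable {g : Type*} [LieRing g] [LieAlgebra ℝ g] {e : Module.Basis (Fin 6) ℝ g}

namespace CPStructure

theorem curvature_smul_left (S : CPStructure g) (a : ℝ) (u v w : g) :
    S.curvature (a • u) v w = a • S.curvature u v w := by
  simp only [curvature, map_smul, LinearMap.smul_apply, smul_lie, smul_sub]

theorem curvature_smul_middle (S : CPStructure g) (a : ℝ) (u v w : g) :
    S.curvature u (a • v) w = a • S.curvature u v w := by
  simp only [curvature, map_smul, LinearMap.smul_apply, lie_smul, smul_sub]

theorem curvature_smul_right (S : CPStructure g) (a : ℝ) (u v w : g) :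
    S.curvature u v (a • w) = a • S.curvature u v w := by
  simp only [curvature, map_smul, smul_sub]

variable {S : CPStructure g}

/-- For `w` in `g₊`, adding to the relation its image under `E` cancels the `J v` term. -/
theorem IsStable.exists_coefficient {B C : Submodule ℝ g} (hB : S.IsStable B) {v : g}
    (hv : S.E v = v) (hvC : ∀ c ∈ C, ∃ a b : ℝ, c - (a • v + b • S.J v) ∈ B) {w : g} (hw : w ∈ C)
    (hwE : S.E w = w) : ∃ a : ℝ, w - a • v ∈ B := by
  obtain ⟨a, b, hab⟩ := hvC w hw
  refine ⟨a, (B.smul_mem_iff (two_ne_zero' ℝ)).1 ?_⟩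
  have h1 := B.add_mem hab (hB.2 _ hab)
  convert h1 using 1
  simp only [map_sub, map_add, map_smul, S.E_J, hv, hwE]
  module

/-- Two vectors which are independent modulo `B` have coordinates with non-zero determinant in
every frame. -/
theorem det_ne_zero_of_frame {B : Submodule ℝ g} {p q v w : g} {x y x' y' : ℝ}
    (hpq : ∀ a b : ℝ, a • p + b • q ∈ B → a = 0 ∧ b = 0)
    (hp : p - (x • v + y • w) ∈ B) (hq : q - (x' • v + y' • w) ∈ B) : x * y' - x' * y ≠ 0 := by
  intro h0
  have h1 := B.sub_mem (B.smul_mem y' hp) (B.smul_mem y hq)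
  have h2 := B.sub_mem (B.smul_mem x' hp) (B.smul_mem x hq)
  have h1' := hpq y' (-y) (by convert h1 using 1; linear_combination (norm := module) h0 • v)
  have h2' := hpq x' (-x) (by convert h2 using 1; linear_combination (norm := module) -h0 • w)
  rw [neg_eq_zero.1 h1'.2, neg_eq_zero.1 h2'.2] at hp
  have := hpq 1 0 (by convert hp using 1; module)
  exact one_ne_zero this.1

variable (e S) in
/-- Coordinates adapted to a complex product structure on a tower algebra: a frame `v₁, v₂, v₃` of
`g₊`, of which only `v = v₃` is recorded, the coordinates `(xᵢ, yᵢ)` of `e i` in the pair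
`v₁, J v₁`, the coordinates `(s, s')`, `(q, q')` of `e 2`, `e 3` in the pair `v₂, J v₂`, and the
coefficients `lᵢ`, `mᵢ`, `nᵢ` of the connection. -/
structure TowerFrame where
  v : g
  (x₀ y₀ x₁ y₁ s s' q q' l₀ l₁ m₀ m₁ n₂ n₃ : ℝ)
  independent : ∀ a b : ℝ, a • v + b • S.J v = 0 → a = 0 ∧ b = 0
  det_ne_zero : x₀ * y₁ - x₁ * y₀ ≠ 0
  det_ne_zero' : s * q' - q * s' ≠ 0
  q_eq : q = l₁ * x₀ - l₀ * x₁
  q'_eq : q' = l₁ * y₀ - l₀ * y₁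
  lie_zero_two : ⁅e 0, e 2⁆ = (m₀ * s - n₂ * x₀) • v + (m₀ * s' - n₂ * y₀) • S.J v
  lie_one_two : ⁅e 1, e 2⁆ = (m₁ * s - n₂ * x₁) • v + (m₁ * s' - n₂ * y₁) • S.J v
  lie_zero_three : ⁅e 0, e 3⁆ = (m₀ * q - n₃ * x₀) • v + (m₀ * q' - n₃ * y₀) • S.J v
  lie_one_three : ⁅e 1, e 3⁆ = (m₁ * q - n₃ * x₁) • v + (m₁ * q' - n₃ * y₁) • S.J v
  isFlat_iff : S.IsFlat ↔ m₀ * l₁ - m₁ * l₀ + n₃ = 0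

end CPStructure

open CPStructure in
-- Every step of the flag `P ⊂ U ⊂ g` is stable, so the frame can be chosen with `v₂ ∈ U` and `v₃ ∈
-- P`. Then `∇_u v₁ ≡ l v₂` modulo `P`, `∇_u v₂ = m v₃` and `∇_w v₁ = n v₃` for `w ∈ U`; also `∇`
-- vanishes on `U × U` and whenever one argument is in `P`. Torsion-freeness gives the brackets. The
-- curvature vanishes once an argument is in `U`, which leaves `R(e₀,e₁)v₁`.
theorem IsTower.nonempty_towerFrame (h : IsTower e)
    (hJ : ∀ J : g →ₗ[ℝ] g, IsComplexStructure J → ∀ x ∈ lastTwo e, J x ∈ lastTwo e)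
    (S : CPStructure g) : Nonempty (TowerFrame e S) := by
  set U := lastFour e with hUdef
  set P := lastTwo e with hPdef
  set D := S.connection with hD
  have sP : S.IsStable P := S.isStable_of_forall hJ
  have sU : S.IsStable U := S.isStable_of_forall fun J h1 => h.map_lastFour h1 (hJ J h1)
  have sBot : S.IsStable ⊥ := ⟨by simp, by simp⟩
  have sTop : S.IsStable ⊤ := ⟨by simp, by simp⟩
  have dU : ∀ u v, D u v ∈ U := fun u v =>
    (sU.connection_mem sTop sTop (fun x _ y _ => h.lie_mem_lastFour x y)
      (Submodule.mem_top (x := u)) (Submodule.mem_top (x := v))).1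
  have dP : ∀ u, ∀ w ∈ U, D u w ∈ P ∧ D w u ∈ P := fun u w hw =>
    sP.connection_mem sU sTop (fun x _ y hy => h.lie_mem_lastTwo x hy) Submodule.mem_top hw
  have d0 : ∀ u, ∀ w ∈ P, D u w = 0 ∧ D w u = 0 := fun u w hw => by
    have := sBot.connection_mem sP sTop (fun x _ y hy => by
      rw [← lie_skew, h.central y hy, neg_zero]; exact Submodule.zero_mem _)
      (Submodule.mem_top (x := u)) hw
    simpa using this
  have dUU : ∀ u ∈ U, ∀ w ∈ U, D u w = 0 := fun u hu w hw => by
    have := (sBot.connection_mem sU sU (fun x hx y hy => by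
      rw [h.abelian x hx y hy]; exact Submodule.zero_mem _) hu hw).1
    simpa using this
  have i1 : ∀ a b : ℝ, a • e 0 + b • e 1 ∈ U → a = 0 ∧ b = 0 := fun a b hab => by
    simpa [hUdef, mem_lastFour, -Module.Basis.coord_apply, coord_basis] using hab
  have i2 : ∀ a b : ℝ, a • e 2 + b • e 3 ∈ P → a = 0 ∧ b = 0 := fun a b hab => by
    simpa [hPdef, mem_lastTwo, -Module.Basis.coord_apply, coord_basis] using hab
  have g1 : ∀ u, u - e.coord 0 u • e 0 - e.coord 1 u • e 1 ∈ U := fun u => by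
    simp [hUdef, mem_lastFour, -Module.Basis.coord_apply, coord_basis]
  obtain ⟨v₁, -, hv₁, hv₁U, c₁⟩ := sU.exists_frame sTop (p := e 0) (q := e 1) Submodule.mem_top
    (fun h0 => one_ne_zero (i1 1 0 (by simpa using h0)).1) (fun u _ => ⟨_, _, g1 u⟩)
  obtain ⟨v₂, hv₂m, hv₂, hv₂P, c₂⟩ := sP.exists_frame sU (p := e 2) (q := e 3)
    basis_mem_lastFour.1 (fun h0 => one_ne_zero (i2 1 0 (by simpa using h0)).1) (fun u hu => by
      obtain ⟨h0, h1⟩ := mem_lastFour.1 hu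
      refine ⟨e.coord 2 u, e.coord 3 u, ?_⟩
      simp [hPdef, mem_lastTwo, -Module.Basis.coord_apply, coord_basis, h0, h1])
  obtain ⟨v₃, -, hv₃, hv₃0, c₃⟩ := sBot.exists_frame sP (p := e 4) (q := e 5)
    basis_mem_lastTwo.1 (by simpa using e.ne_zero 4) (fun u hu => by
      refine ⟨e.coord 4 u, e.coord 5 u, ?_⟩
      rw [Submodule.mem_bot]
      nth_rewrite 1 [eq_combination_of_mem_lastTwo hu]
      abel)
  obtain ⟨x₀, y₀, hx₀⟩ := c₁ (e 0) Submodule.mem_top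
  obtain ⟨x₁, y₁, hx₁⟩ := c₁ (e 1) Submodule.mem_top
  obtain ⟨s, s', hs⟩ := c₂ (e 2) basis_mem_lastFour.1
  obtain ⟨q, q', hq⟩ := c₂ (e 3) basis_mem_lastFour.2
  have hl : ∀ u, ∃ l : ℝ, D u v₁ - l • v₂ ∈ P := fun u =>
    sP.exists_coefficient hv₂ c₂ (dU u v₁) (E_connection_of_pos hv₁)
  have hm : ∀ u, ∃ m : ℝ, D u v₂ = m • v₃ := fun u => by
    obtain ⟨m, h1⟩ := sBot.exists_coefficient hv₃ c₃ (dP u v₂ hv₂m).1 (E_connection_of_pos hv₂)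
    exact ⟨m, sub_eq_zero.1 (by simpa using h1)⟩
  have hn : ∀ w ∈ U, ∃ n : ℝ, D w v₁ = n • v₃ := fun w hw => by
    obtain ⟨m, h1⟩ := sBot.exists_coefficient hv₃ c₃ (dP v₁ w hw).2 (E_connection_of_pos hv₁)
    exact ⟨m, sub_eq_zero.1 (by simpa using h1)⟩
  obtain ⟨l₀, hl₀⟩ := hl (e 0)
  obtain ⟨l₁, hl₁⟩ := hl (e 1)
  obtain ⟨m₀, hm₀⟩ := hm (e 0)
  obtain ⟨m₁, hm₁⟩ := hm (e 1)
  obtain ⟨n₂, hn₂⟩ := hn (e 2) basis_mem_lastFour.1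
  obtain ⟨n₃, hn₃⟩ := hn (e 3) basis_mem_lastFour.2
  have hlie : ∀ {u w : g} {m n a b x y : ℝ}, w ∈ U → D u v₂ = m • v₃ → D w v₁ = n • v₃ →
      w - (a • v₂ + b • S.J v₂) ∈ P → u - (x • v₁ + y • S.J v₁) ∈ U →
      ⁅u, w⁆ = (m * a - n * x) • v₃ + (m * b - n * y) • S.J v₃ := by
    intro u w m n a b x y hw hm hn hwP huU
    have h1 := (d0 u _ hwP).1
    have h2 := dUU w hw _ huU
    rw [map_sub, map_add, map_smul, map_smul, hD, connection_J, ← hD, hm, map_smul] at h1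
    rw [map_sub, map_add, map_smul, map_smul, hD, connection_J, ← hD, hn, map_smul] at h2
    rw [← S.connection_sub, ← hD]
    linear_combination (norm := module) h1 - h2
  -- Compare `∇_{e₀}e₁ - ∇_{e₁}e₀ = -e₃` modulo `P`; this yields the formulas for `q` and `q'`.
  have hlie01 : (l₀ * x₁ - l₁ * x₀ + q) • v₂ + (l₀ * y₁ - l₁ * y₀ + q') • S.J v₂ ∈ P := by
    have h1 := (dP (e 0) _ hx₁).1
    have h2 := (dP (e 1) _ hx₀).1
    rw [map_sub, map_add, map_smul, map_smul, hD, connection_J, ← hD] at h1 h2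
    have h3 := sP.1 _ hl₀
    have h4 := sP.1 _ hl₁
    have h5 : D (e 0) (e 1) - D (e 1) (e 0) + e 3 = 0 := by
      rw [hD, S.connection_sub, h.lie_zero_one, neg_add_cancel]
    have h6 := (P.sub_mem (P.sub_mem (P.sub_mem (P.sub_mem (P.add_mem
      (P.add_mem (P.smul_mem x₀ hl₁) (P.smul_mem y₀ h4)) h2) (P.smul_mem x₁ hl₀))
      (P.smul_mem y₁ h3)) h1) hq)
    convert h6 using 1
    simp only [map_sub, map_smul]
    linear_combination (norm := module) h5
  obtain ⟨hq1, hq2⟩ := sP.eq_zero_of_mem hv₂P hlie01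
  have k0 : ∀ u v w, u ∈ U → S.curvature u v w = 0 := fun u v w hu => by
    have h1 : ⁅u, v⁆ ∈ P := by
      rw [← lie_skew]; exact P.neg_mem (h.lie_mem_lastTwo v hu)
    rw [curvature, ← hD, dUU u hu _ (dU v w), (d0 v _ (dP w u hu).2).1, (d0 w _ h1).2]
    simp
  have k1 : ∀ u v w, v ∈ U → S.curvature u v w = 0 := fun u v w hv => by
    rw [curvature_swap, k0 v u w hv, neg_zero]
  have k2 : ∀ u v w, w ∈ U → S.curvature u v w = 0 := fun u v w hw => by
    rw [curvature, ← hD, (d0 u _ (dP v w hw).1).1, (d0 v _ (dP u w hw).1).1,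
      dUU _ (h.lie_mem_lastFour u v) w hw]
    simp
  have hR : S.curvature (e 0) (e 1) v₁ = (m₀ * l₁ - m₁ * l₀ + n₃) • v₃ := by
    have h1 := (d0 (e 0) _ hl₁).1
    have h2 := (d0 (e 1) _ hl₀).1
    rw [map_sub, map_smul, hm₀] at h1
    rw [map_sub, map_smul, hm₁] at h2
    rw [curvature, ← hD, h.lie_zero_one, map_neg, LinearMap.neg_apply, hn₃]
    linear_combination (norm := module) h1 - h2
  refine ⟨⟨v₃, x₀, y₀, x₁, y₁, s, s', q, q', l₀, l₁, m₀, m₁, n₂, n₃,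
    fun a b hab => sBot.eq_zero_of_mem hv₃0 (by simpa using hab),
    det_ne_zero_of_frame i1 hx₀ hx₁, det_ne_zero_of_frame i2 hs hq, by linarith, by linarith,
    hlie basis_mem_lastFour.1 hm₀ hn₂ hs hx₀, hlie basis_mem_lastFour.1 hm₁ hn₂ hs hx₁,
    hlie basis_mem_lastFour.2 hm₀ hn₃ hq hx₀, hlie basis_mem_lastFour.2 hm₁ hn₃ hq hx₁, ?_⟩⟩
  constructor
  · intro hf
    have h1 := hf (e 0) (e 1) v₁
    rw [hR] at h1
    exact (smul_eq_zero.1 h1).resolve_right (by simpa using hv₃0)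
  · intro hz u v w
    rw [hz, zero_smul] at hR
    have e1 : ∀ u : g, u = (u - e.coord 0 u • e 0 - e.coord 1 u • e 1)
        + (e.coord 0 u • e 0 + e.coord 1 u • e 1) := fun u => by abel
    have hself : ∀ u w : g, S.curvature u u w = 0 := fun u w => by simp [curvature]
    obtain ⟨a, b, hab⟩ := c₁ w Submodule.mem_top
    have e2 : w = (w - (a • v₁ + b • S.J v₁)) + (a • v₁ + b • S.J v₁) := by abel
    rw [e1 u, curvature_add_left, k0 _ _ _ (g1 u), e1 v, curvature_add_middle, k1 _ _ _ (g1 v), e2,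
      curvature_add_right, k2 _ _ _ hab]
    simp only [curvature_add_left, curvature_add_middle, curvature_add_right, curvature_smul_left,
      curvature_smul_middle, curvature_smul_right, curvature_J, hself, hR,
      S.curvature_swap (e 1) (e 0), map_zero, smul_zero, neg_zero, add_zero]

end ComplexProduct

/-! ### Invariance of the plane `P` under every complex structure -/

namespace ComplexProduct

variable {g : Type*} [LieRing g] [LieAlgebra ℝ g] {e : Module.Basis (Fin 6) ℝ g}

/-- For a central vector `z`, the operator `ad (J z)` commutes with `J`. -/
theorem IsComplexStructure.lie_of_central {J : g →ₗ[ℝ] g} (hJ : IsComplexStructure J) {z : g}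
    (hz : ∀ y : g, ⁅z, y⁆ = 0) (y : g) : J ⁅J z, y⁆ = ⁅J z, J y⁆ := by
  have h1 := hJ.integrable z y
  rw [hz, hz, map_zero, add_zero] at h1
  have h2 := congrArg J h1
  rw [map_zero, map_add, hJ.sq] at h2
  linear_combination (norm := module) -h2

variable (e) in
/-- `e` is a basis for which the structure equations of the tuple `t` hold. -/
def SatisfiesEquations (t : Tuple) : Prop :=
  ∀ (k : Fin 6) (x y : g),
    -(e.coord k ⁅x, y⁆) = twoForm (t k) (fun i => e.coord i x) (fun i => e.coord i y)

theorem SatisfiesEquations.coord_lie {t : Tuple} (h : SatisfiesEquations e t) (k : Fin 6)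
    (x y : g) :
    e.coord k ⁅x, y⁆ = -twoForm (t k) (fun i => e.coord i x) (fun i => e.coord i y) := by
  rw [← h k x y, neg_neg]

/-- `h4` and `h5` say that the last two forms vanish on `U × U` and on `P × g`; `h01` says that
`[e₀,e₁]` has no component other than along `e 3`. -/
theorem SatisfiesEquations.isTower {t : Tuple} (h : SatisfiesEquations e t) (h0 : t 0 = [])
    (h1 : t 1 = []) (h2 : t 2 = []) (h3 : t 3 = [(0, 1)])
    (h4 : ∀ x y : Fin 6 → ℝ, x 0 = 0 → x 1 = 0 →
      ((y 0 = 0 ∧ y 1 = 0) ∨ (x 2 = 0 ∧ x 3 = 0)) → twoForm (t 4) x y = 0)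
    (h5 : ∀ x y : Fin 6 → ℝ, x 0 = 0 → x 1 = 0 →
      ((y 0 = 0 ∧ y 1 = 0) ∨ (x 2 = 0 ∧ x 3 = 0)) → twoForm (t 5) x y = 0)
    (h01 : ∀ k, k ≠ 3 → twoForm (t k) (Pi.single 0 1) (Pi.single 1 1) = 0) : IsTower e := by
  have key : ∀ x y : g, e.coord 0 x = 0 → e.coord 1 x = 0 →
      ((e.coord 0 y = 0 ∧ e.coord 1 y = 0) ∨ (e.coord 2 x = 0 ∧ e.coord 3 x = 0)) →
      ⁅x, y⁆ = 0 := by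
    intro x y hx0 hx1 hxy
    refine eq_of_coord_eq (e := e) fun k => ?_
    rw [h.coord_lie, map_zero, neg_eq_zero]
    fin_cases k
    · simp [h0, twoForm]
    · simp [h1, twoForm]
    · simp [h2, twoForm]
    · simp [h3, twoForm, -Module.Basis.coord_apply, hx0, hx1]
    · exact h4 _ _ hx0 hx1 hxy
    · exact h5 _ _ hx0 hx1 hxy
  refine ⟨fun x y => ?_, fun x y => ?_, fun x y => ?_, fun x y => ?_, fun x hx y hy => ?_,
    fun x hx y => ?_, ?_⟩
  · simp [h.coord_lie, h0, twoForm, -Module.Basis.coord_apply]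
  · simp [h.coord_lie, h1, twoForm, -Module.Basis.coord_apply]
  · simp [h.coord_lie, h2, twoForm, -Module.Basis.coord_apply]
  · simp [h.coord_lie, h3, twoForm, -Module.Basis.coord_apply]
  · exact key x y (mem_lastFour.1 hx).1 (mem_lastFour.1 hx).2 (Or.inl (mem_lastFour.1 hy))
  · obtain ⟨hx0, hx1, hx2⟩ := mem_lastTwo.1 hx
    exact key x y hx0 hx1 (Or.inr hx2)
  · have hs : ∀ j : Fin 6, (fun i => e.coord i (e j)) = Pi.single j 1 := fun j => by
      funext i
      rw [coord_basis, Pi.single_apply]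
      simp [eq_comm]
    refine eq_of_coord_eq (e := e) fun k => ?_
    rw [h.coord_lie, hs, hs, map_neg, coord_basis]
    split_ifs with hk
    · subst hk
      simp [h3, twoForm]
    · rw [h01 k (Ne.symm hk)]

/-- Let `w = J e₅`. Whenever `[w,eⱼ] = a e₅`, commuting `ad w` with `J` gives `a w = [w,Jeⱼ]`. For
`j = 3, 2, 1, 0` in turn, `a` is up to sign the next coordinate of `w`, and that coordinate of
`[w,Jeⱼ]` is zero; so its square vanishes. -/
theorem lastTwo_stable_of_12_13_14add23
    (h : SatisfiesEquations e ![[], [], [], [(0, 1)], [(0, 2)], [(0, 3), (1, 2)]]) :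
    IsTower e ∧ ∀ J : g →ₗ[ℝ] g, IsComplexStructure J → ∀ x ∈ lastTwo e, J x ∈ lastTwo e := by
  have ht : IsTower e := h.isTower rfl rfl rfl rfl
    (by rintro x y h0 h1 (⟨h2, h3⟩ | ⟨h2, h3⟩) <;> simp [twoForm, h0, h2])
    (by rintro x y h0 h1 (⟨h2, h3⟩ | ⟨h2, h3⟩) <;> simp [twoForm, h0, h1, h2, h3])
    (by intro k hk; fin_cases k <;> simp_all [twoForm])
  refine ⟨ht, fun J hJ => hJ.map_lastTwo_of_exists ⟨e 5, basis_mem_lastTwo.2, e.ne_zero 5, ?_⟩⟩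
  have hc := hJ.lie_of_central (ht.central _ basis_mem_lastTwo.2)
  have c4 : ∀ x y : g, e.coord 4 ⁅x, y⁆ = -(e.coord 0 x * e.coord 2 y - e.coord 0 y * e.coord 2 x) :=
    fun x y => by simp [h.coord_lie, twoForm, -Module.Basis.coord_apply]
  have c5 : ∀ x y : g, e.coord 5 ⁅x, y⁆ = -((e.coord 0 x * e.coord 3 y - e.coord 0 y * e.coord 3 x)
      + (e.coord 1 x * e.coord 2 y - e.coord 1 y * e.coord 2 x)) :=
    fun x y => by simp [h.coord_lie, twoForm, -Module.Basis.coord_apply]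
  set w := J (e 5) with hw
  have hb : ∀ (j : Fin 6) (a : ℝ), ⁅w, e j⁆ = a • e 5 → a • w = ⁅w, J (e j)⁆ := fun j a h1 => by
    rw [← hc, h1, map_smul]
  have w0 : e.coord 0 w = 0 := by
    have h1 := hb 3 (-e.coord 0 w) (eq_of_coord_eq (e := e) fun k => by
      fin_cases k <;> simp [-Module.Basis.coord_apply, coord_basis, ht.coord_zero, ht.coord_one,
        ht.coord_two, ht.coord_three, c4, c5])
    have h2 := congrArg (e.coord 0) h1
    rw [ht.coord_zero, map_smul] at h2
    simpa [-Module.Basis.coord_apply] using h2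
  have w1 : e.coord 1 w = 0 := by
    have h1 := hb 2 (-e.coord 1 w) (eq_of_coord_eq (e := e) fun k => by
      fin_cases k <;> simp [-Module.Basis.coord_apply, coord_basis, ht.coord_zero, ht.coord_one,
        ht.coord_two, ht.coord_three, c4, c5, w0])
    have h2 := congrArg (e.coord 1) h1
    rw [ht.coord_one, map_smul] at h2
    simpa [-Module.Basis.coord_apply] using h2
  have w2 : e.coord 2 w = 0 := by
    have h1 := hb 1 (e.coord 2 w) (eq_of_coord_eq (e := e) fun k => by
      fin_cases k <;> simp [-Module.Basis.coord_apply, coord_basis, ht.coord_zero, ht.coord_one,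
        ht.coord_two, ht.coord_three, c4, c5, w0])
    have h2 := congrArg (e.coord 2) h1
    rw [ht.coord_two, map_smul] at h2
    simpa [-Module.Basis.coord_apply] using h2
  have w3 : e.coord 3 w = 0 := by
    have h1 := hb 0 (e.coord 3 w) (eq_of_coord_eq (e := e) fun k => by
      fin_cases k <;> simp [-Module.Basis.coord_apply, coord_basis, ht.coord_zero, ht.coord_one,
        ht.coord_two, ht.coord_three, c4, c5, w0, w1, w2])
    have h2 := congrArg (e.coord 3) h1
    rw [ht.coord_three, map_smul, w0, w1] at h2
    simpa [-Module.Basis.coord_apply] using h2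
  exact mem_lastTwo.2 ⟨w0, w1, w2, w3⟩

theorem lastTwo_stable_of_12_14_24
    (h : SatisfiesEquations e ![[], [], [], [(0, 1)], [(0, 3)], [(1, 3)]]) :
    IsTower e ∧ ∀ J : g →ₗ[ℝ] g, IsComplexStructure J → ∀ x ∈ lastTwo e, J x ∈ lastTwo e := by
  have ht : IsTower e := h.isTower rfl rfl rfl rfl
    (by rintro x y h0 h1 (⟨h2, h3⟩ | ⟨h2, h3⟩) <;> simp [twoForm, h0, h2, h3])
    (by rintro x y h0 h1 (⟨h2, h3⟩ | ⟨h2, h3⟩) <;> simp [twoForm, h1, h3])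
    (by intro k hk; fin_cases k <;> simp_all [twoForm])
  refine ⟨ht, fun J hJ => ?_⟩
  have c4 : ∀ x y : g, e.coord 4 ⁅x, y⁆ = -(e.coord 0 x * e.coord 3 y - e.coord 0 y * e.coord 3 x) :=
    fun x y => by simp [h.coord_lie, twoForm, -Module.Basis.coord_apply]
  have c5 : ∀ x y : g, e.coord 5 ⁅x, y⁆ = -(e.coord 1 x * e.coord 3 y - e.coord 1 y * e.coord 3 x) :=
    fun x y => by simp [h.coord_lie, twoForm, -Module.Basis.coord_apply]
  refine hJ.map_lastTwo_of_exists ?_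
  -- From here on, assume that `P ∩ J P = 0`.
  by_contra! hne
  have hc : ∀ z ∈ lastTwo e, ∀ y, J ⁅J z, y⁆ = ⁅J z, J y⁆ := fun z hz =>
    hJ.lie_of_central (ht.central z hz)
  have hzero : ∀ p ∈ lastTwo e, J p ∈ lastTwo e → p = 0 := fun p hp hJp => by
    by_contra h0
    exact hne p hp h0 hJp
  have w01 : ∀ z ∈ lastTwo e, e.coord 0 (J z) = 0 ∧ e.coord 1 (J z) = 0 := by
    intro z hz
    set w := J z with hw
    set p := ⁅w, e 3⁆ with hp
    have hpe : p = (-e.coord 0 w) • e 4 + (-e.coord 1 w) • e 5 :=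
      eq_of_coord_eq (e := e) fun k => by
        fin_cases k <;> simp [-Module.Basis.coord_apply, coord_basis, ht.coord_zero, ht.coord_one,
          ht.coord_two, ht.coord_three, c4, c5, hp]
    have hpm : p ∈ lastTwo e := ht.lie_mem_lastTwo _ basis_mem_lastFour.2
    -- The vector `J p = [w,Je₃]` has no coordinates 0, 1, 2, so `[w,Jp]` is its coordinate 3 times
    -- `p`; but `[w,Jp] = J[w,p] = 0`. If that coordinate is zero, `J p ∈ P`, and again `p = 0`.
    have hp0 : p = 0 := by
      have h1 : J p = ⁅w, J (e 3)⁆ := hc z hz _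
      have h2 : ⁅w, J p⁆ = 0 := by
        rw [← hc z hz, ← lie_skew, ht.central p hpm, neg_zero, map_zero]
      have h3 : ⁅w, J p⁆ = e.coord 3 (J p) • p := by
        refine eq_of_coord_eq (e := e) fun k => ?_
        rw [h1]
        fin_cases k <;> simp [-Module.Basis.coord_apply, coord_basis, ht.coord_zero, ht.coord_one,
          ht.coord_two, ht.coord_three, c4, c5, hpe] <;> ring
      rw [h2] at h3
      rcases smul_eq_zero.1 h3.symm with h4 | h4
      · refine hzero p hpm (mem_lastTwo.2 ?_)
        refine ⟨?_, ?_, ?_, h4⟩ <;> rw [h1]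
        exacts [ht.coord_zero _ _, ht.coord_one _ _, ht.coord_two _ _]
      · exact h4
    constructor
    · have := congrArg (e.coord 4) hp0
      rw [hpe] at this
      simpa [-Module.Basis.coord_apply, coord_basis] using this
    · have := congrArg (e.coord 5) hp0
      rw [hpe] at this
      simpa [-Module.Basis.coord_apply, coord_basis] using this
  have w3 : ∀ z ∈ lastTwo e, e.coord 3 (J z) = 0 := by
    intro z hz
    obtain ⟨w0, w1⟩ := w01 z hz
    have hpe : ⁅J z, e 0⁆ = e.coord 3 (J z) • e 4 :=
      eq_of_coord_eq (e := e) fun k => by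
        fin_cases k <;> simp [-Module.Basis.coord_apply, coord_basis, ht.coord_zero, ht.coord_one,
          ht.coord_two, ht.coord_three, c4, c5, w0, w1]
    have h1 := hzero (e.coord 3 (J z) • e 4)
      ((lastTwo e).smul_mem _ basis_mem_lastTwo.1) (by
        rw [← hpe, hc z hz, ← lie_skew]
        exact (lastTwo e).neg_mem (ht.lie_mem_lastTwo _ (mem_lastFour.2 ⟨w0, w1⟩)))
    exact (smul_eq_zero.1 h1).resolve_right (e.ne_zero 4)
  -- Now `J P ⊂ P + ℝe₂`. The combination chosen is in the kernel of `z ↦ e.coord 2 (J z)` on the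
  -- plane `P`, so `J` sends it into `P`.
  have hp := hzero (e.coord 2 (J (e 5)) • e 4 - e.coord 2 (J (e 4)) • e 5)
    ((lastTwo e).sub_mem ((lastTwo e).smul_mem _ basis_mem_lastTwo.1)
      ((lastTwo e).smul_mem _ basis_mem_lastTwo.2)) (by
    obtain ⟨a0, a1⟩ := w01 _ (basis_mem_lastTwo (e := e)).1
    obtain ⟨b0, b1⟩ := w01 _ (basis_mem_lastTwo (e := e)).2
    have a3 := w3 _ (basis_mem_lastTwo (e := e)).1
    have b3 := w3 _ (basis_mem_lastTwo (e := e)).2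
    simp [mem_lastTwo, -Module.Basis.coord_apply, a0, a1, b0, b1, a3, b3]
    ring)
  have h2 : e.coord 2 (J (e 4)) = 0 := by
    have := congrArg (e.coord 5) hp
    simpa [-Module.Basis.coord_apply, coord_basis] using this
  obtain ⟨a0, a1⟩ := w01 _ (basis_mem_lastTwo (e := e)).1
  exact e.ne_zero 4 (hzero _ basis_mem_lastTwo.1
    (mem_lastTwo.2 ⟨a0, a1, h2, w3 _ basis_mem_lastTwo.1⟩))

theorem lastTwo_stable_of_12_13_24
    (h : SatisfiesEquations e ![[], [], [], [(0, 1)], [(0, 2)], [(1, 3)]]) :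
    IsTower e ∧ ∀ J : g →ₗ[ℝ] g, IsComplexStructure J → ∀ x ∈ lastTwo e, J x ∈ lastTwo e := by
  have ht : IsTower e := h.isTower rfl rfl rfl rfl
    (by rintro x y h0 h1 (⟨h2, h3⟩ | ⟨h2, h3⟩) <;> simp [twoForm, h0, h2])
    (by rintro x y h0 h1 (⟨h2, h3⟩ | ⟨h2, h3⟩) <;> simp [twoForm, h1, h3])
    (by intro k hk; fin_cases k <;> simp_all [twoForm])
  refine ⟨ht, fun J hJ => ?_⟩
  have c4 : ∀ x y : g, e.coord 4 ⁅x, y⁆ = -(e.coord 0 x * e.coord 2 y - e.coord 0 y * e.coord 2 x) :=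
    fun x y => by simp [h.coord_lie, twoForm, -Module.Basis.coord_apply]
  have c5 : ∀ x y : g, e.coord 5 ⁅x, y⁆ = -(e.coord 1 x * e.coord 3 y - e.coord 1 y * e.coord 3 x) :=
    fun x y => by simp [h.coord_lie, twoForm, -Module.Basis.coord_apply]
  refine hJ.map_lastTwo_of_exists ?_
  by_contra! hne
  have n4 : J (e 4) ∉ lastTwo e := hne _ basis_mem_lastTwo.1 (e.ne_zero 4)
  have n5 : J (e 5) ∉ lastTwo e := hne _ basis_mem_lastTwo.2 (e.ne_zero 5)
  have hc := hJ.lie_of_central (ht.central _ basis_mem_lastTwo.2)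
  have hc' := hJ.lie_of_central (ht.central _ basis_mem_lastTwo.1)
  set w := J (e 5) with hw
  set w' := J (e 4) with hw'
  have w1 : e.coord 1 w = 0 := by
    have h1 : ⁅w, e 3⁆ = (-e.coord 1 w) • e 5 := eq_of_coord_eq (e := e) fun k => by
      fin_cases k <;> simp [-Module.Basis.coord_apply, coord_basis, ht.coord_zero, ht.coord_one,
        ht.coord_two, ht.coord_three, c4, c5]
    have h2 := congrArg (e.coord 1) (hc (e 3))
    rw [ht.coord_one, h1, map_smul, map_smul, ← hw] at h2
    simpa [-Module.Basis.coord_apply] using h2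
  have hmem : ∀ a y : g, ∀ t : ℝ, t ≠ 0 → t • w' = ⁅a, y⁆ → e.coord 3 ⁅a, y⁆ = 0 → False := by
    intro a y t ht0 h1 h2
    refine n4 (((lastTwo e).smul_mem_iff ht0).1 ?_)
    rw [h1]
    exact mem_lastTwo.2 ⟨ht.coord_zero _ _, ht.coord_one _ _, ht.coord_two _ _, h2⟩
  -- If `w = J e₅` has no `e 0` component, either `w ∈ P` or a non-zero multiple of `w' = J e₄` is a
  -- bracket lying in `P`. Otherwise `w'` is itself a multiple of a bracket, and `w'₃ w = [w',Je₁]`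
  -- forces `w'₃ = 0`, so `w' ∈ P`.
  by_cases w0 : e.coord 0 w = 0
  · have w3 : e.coord 3 w = 0 := by
      have h1 : ⁅w, e 1⁆ = e.coord 3 w • e 5 := eq_of_coord_eq (e := e) fun k => by
        fin_cases k <;> simp [-Module.Basis.coord_apply, coord_basis, ht.coord_zero, ht.coord_one,
          ht.coord_two, ht.coord_three, c4, c5, w0]
      have h2 := congrArg (e.coord 3) (hc (e 1))
      rw [ht.coord_three, h1, map_smul, map_smul, ← hw, w0, w1] at h2
      simpa [-Module.Basis.coord_apply] using h2
    by_cases w2 : e.coord 2 w = 0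
    · exact n5 (mem_lastTwo.2 ⟨w0, w1, w2, w3⟩)
    · have h1 : ⁅w, e 0⁆ = e.coord 2 w • e 4 := eq_of_coord_eq (e := e) fun k => by
        fin_cases k <;> simp [-Module.Basis.coord_apply, coord_basis, ht.coord_zero, ht.coord_one,
          ht.coord_two, ht.coord_three, c4, c5, w1]
      refine hmem w (J (e 0)) _ w2 (by rw [← hc, h1, map_smul]) ?_
      rw [ht.coord_three, w0, w1]; ring
  · have h1 : ⁅w, e 2⁆ = (-e.coord 0 w) • e 4 := eq_of_coord_eq (e := e) fun k => by
      fin_cases k <;> simp [-Module.Basis.coord_apply, coord_basis, ht.coord_zero, ht.coord_one,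
        ht.coord_two, ht.coord_three, c4, c5, w1]
    have h2 : (-e.coord 0 w) • w' = ⁅w, J (e 2)⁆ := by rw [← hc, h1, map_smul]
    have hw'k : ∀ k, (∀ x y : g, e.coord k ⁅x, y⁆ = 0) → e.coord k w' = 0 := fun k hk => by
      have := congrArg (e.coord k) h2
      rw [hk, map_smul] at this
      simpa [-Module.Basis.coord_apply, w0] using this
    have u0 := hw'k 0 ht.coord_zero
    have u1 := hw'k 1 ht.coord_one
    have u2 := hw'k 2 ht.coord_two
    have h3 : ⁅w', e 1⁆ = e.coord 3 w' • e 5 := eq_of_coord_eq (e := e) fun k => by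
      fin_cases k <;> simp [-Module.Basis.coord_apply, coord_basis, ht.coord_zero, ht.coord_one,
        ht.coord_two, ht.coord_three, c4, c5, u0]
    have h4 := congrArg (e.coord 0) (hc' (e 1))
    rw [ht.coord_zero, h3, map_smul, map_smul, ← hw] at h4
    have u3 : e.coord 3 w' = 0 := by simpa [-Module.Basis.coord_apply, w0] using h4
    exact n4 (mem_lastTwo.2 ⟨u0, u1, u2, u3⟩)

end ComplexProduct

/-! ### The curvature coefficient of the three tower algebras -/

namespace ComplexProduct

variable {g : Type*} [LieRing g] [LieAlgebra ℝ g] {e : Module.Basis (Fin 6) ℝ g}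

theorem eq_zero_of_det_ne_zero {x y x' y' a b : ℝ} (hdet : x * y' - x' * y ≠ 0)
    (h1 : a * x + b * x' = 0) (h2 : a * y + b * y' = 0) : a = 0 ∧ b = 0 := by
  constructor
  · refine (mul_eq_zero.1 ?_).resolve_right hdet
    linear_combination y' * h1 - x' * h2
  · refine (mul_eq_zero.1 ?_).resolve_right hdet
    linear_combination x * h2 - y * h1

namespace CPStructure

variable {S : CPStructure g}

theorem TowerFrame.eq_of_lie_eq (F : TowerFrame e S) {a b a' b' : ℝ}
    (h : a • F.v + b • S.J F.v = a' • F.v + b' • S.J F.v) : a = a' ∧ b = b' := by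
  obtain ⟨h1, h2⟩ := F.independent (a - a') (b - b') (by linear_combination (norm := module) h)
  exact ⟨sub_eq_zero.1 h1, sub_eq_zero.1 h2⟩

theorem TowerFrame.eq_zero_of_lie_eq (F : TowerFrame e S) {a b : ℝ} {u : g}
    (hu : u = a • F.v + b • S.J F.v) (h : u = 0) : a = 0 ∧ b = 0 :=
  F.independent a b (hu ▸ h)

theorem TowerFrame.det_ne_zero_of_neg_basis (F : TowerFrame e S) {i j : Fin 6} (hij : i ≠ j)
    {a b a' b' : ℝ} (h1 : -e i = a • F.v + b • S.J F.v) (h2 : -e j = a' • F.v + b' • S.J F.v) :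
    a * b' - a' * b ≠ 0 := by
  refine det_ne_zero_of_frame (B := (⊥ : Submodule ℝ g)) (p := -e i) (q := -e j) (v := F.v)
    (w := S.J F.v) (fun c d hcd => ?_) (by simp [h1]) (by simp [h2])
  rw [Submodule.mem_bot] at hcd
  have hi := congrArg (e.coord i) hcd
  have hj := congrArg (e.coord j) hcd
  simp [-Module.Basis.coord_apply, coord_basis, hij, hij.symm] at hi hj
  exact ⟨hi, hj⟩

end CPStructure

open CPStructure

/-- The hypotheses encode `[e₁,e₃] = 0`, `[e₀,e₃] = [e₁,e₂]` and the independence of `[e₀,e₂]` and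
`[e₁,e₂]`. The first gives `m₁l₁ = 0` and `n₃ = -m₁l₀`. If `m₁ = 0`, the second gives `m₀l₁ = n₃ =
0`; if `l₁ = 0 ≠ m₁`, independence fails. -/
theorem curvature_coefficient_eq_zero {x₀ y₀ x₁ y₁ s s' q q' l₀ l₁ m₀ m₁ n₂ n₃ : ℝ}
    (hE : x₀ * y₁ - x₁ * y₀ ≠ 0) (hq : q = l₁ * x₀ - l₀ * x₁)
    (hq' : q' = l₁ * y₀ - l₀ * y₁)
    (hdet : (m₀ * s - n₂ * x₀) * (m₁ * s' - n₂ * y₁) - (m₁ * s - n₂ * x₁) * (m₀ * s' - n₂ * y₀) ≠ 0)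
    (p1 : m₁ * q - n₃ * x₁ = 0) (p2 : m₁ * q' - n₃ * y₁ = 0)
    (r1 : m₀ * q - n₃ * x₀ = m₁ * s - n₂ * x₁) (r2 : m₀ * q' - n₃ * y₀ = m₁ * s' - n₂ * y₁) :
    m₀ * l₁ - m₁ * l₀ + n₃ = 0 := by
  subst hq hq'
  obtain ⟨k1, k2⟩ := eq_zero_of_det_ne_zero (a := m₁ * l₁) (b := -(m₁ * l₀ + n₃)) hE
    (by linear_combination p1) (by linear_combination p2)
  by_contra hF
  have hm₁ : m₁ ≠ 0 := by
    rintro rfl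
    obtain ⟨k3, -⟩ := eq_zero_of_det_ne_zero (a := m₀ * l₁ - n₃) (b := n₂ - m₀ * l₀) hE
      (by linear_combination r1) (by linear_combination r2)
    apply hF
    linear_combination k3 - 2 * k2
  have hl₁ : l₁ = 0 := (mul_eq_zero.1 k1).resolve_left hm₁
  subst hl₁
  apply hdet
  have hn₃ : n₃ = -(m₁ * l₀) := by linear_combination -k2
  subst hn₃
  -- With `l₁ = 0`, both `[e₁,e₂]` and `m₁[e₀,e₂]` have coordinates proportional to `m₁(x₀,y₀) -
  -- m₀(x₁,y₁)`.
  refine (mul_eq_zero.1 (?_ : m₁ * _ = 0)).resolve_left hm₁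
  linear_combination
    (m₀ * n₂) * (y₁ * r1 - x₁ * r2) - (m₁ * n₂) * (y₀ * r1 - x₀ * r2)

theorem isFlat_of_12_13_14add23
    (h : SatisfiesEquations e ![[], [], [], [(0, 1)], [(0, 2)], [(0, 3), (1, 2)]])
    (S : CPStructure g) : S.IsFlat := by
  obtain ⟨ht, hJ⟩ := lastTwo_stable_of_12_13_14add23 h
  obtain ⟨F⟩ := ht.nonempty_towerFrame hJ S
  have hlie : ∀ i j x, (∀ k, e.coord k ⁅e i, e j⁆ = e.coord k x) → ⁅e i, e j⁆ = x :=
    fun i j x => eq_of_coord_eq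
  have b02 : ⁅e 0, e 2⁆ = -e 4 := hlie _ _ _ fun k => by
    rw [h.coord_lie]
    fin_cases k <;> simp [twoForm, -Module.Basis.coord_apply, coord_basis]
  have b03 : ⁅e 0, e 3⁆ = -e 5 := hlie _ _ _ fun k => by
    rw [h.coord_lie]
    fin_cases k <;> simp [twoForm, -Module.Basis.coord_apply, coord_basis]
  have b12 : ⁅e 1, e 2⁆ = -e 5 := hlie _ _ _ fun k => by
    rw [h.coord_lie]
    fin_cases k <;> simp [twoForm, -Module.Basis.coord_apply, coord_basis]
  have b13 : ⁅e 1, e 3⁆ = 0 := hlie _ _ _ fun k => by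
    rw [h.coord_lie]
    fin_cases k <;> simp [twoForm, -Module.Basis.coord_apply, coord_basis]
  have hdet := F.det_ne_zero_of_neg_basis (i := 4) (j := 5) (by decide)
    (b02.symm.trans F.lie_zero_two) (b12.symm.trans F.lie_one_two)
  obtain ⟨p1, p2⟩ := F.eq_zero_of_lie_eq F.lie_one_three b13
  obtain ⟨r1, r2⟩ := F.eq_of_lie_eq
    (F.lie_zero_three.symm.trans (b03.trans (b12.symm.trans F.lie_one_two)))
  rw [F.isFlat_iff]
  exact curvature_coefficient_eq_zero F.det_ne_zero F.q_eq F.q'_eq hdet p1 p2 r1 r2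

/-- Since `[e₀,e₂] = [e₁,e₂] = 0`, both `n₂(x₀,y₀)` and `n₂(x₁,y₁)` are multiples of `(s,s')`, so
`n₂ = 0` and then `m₀ = m₁ = 0`. The coefficient is now `n₃`, and `n₃ = 0` would make `[e₀,e₃]` and
`[e₁,e₃]` vanish. -/
theorem curvature_coefficient_ne_zero {x₀ y₀ x₁ y₁ s s' q q' l₀ l₁ m₀ m₁ n₂ n₃ : ℝ}
    (hE : x₀ * y₁ - x₁ * y₀ ≠ 0) (hS : s * q' - q * s' ≠ 0)
    (hdet : (m₀ * q - n₃ * x₀) * (m₁ * q' - n₃ * y₁) - (m₁ * q - n₃ * x₁) * (m₀ * q' - n₃ * y₀) ≠ 0)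
    (p1 : m₀ * s - n₂ * x₀ = 0) (p2 : m₀ * s' - n₂ * y₀ = 0)
    (r1 : m₁ * s - n₂ * x₁ = 0) (r2 : m₁ * s' - n₂ * y₁ = 0) :
    m₀ * l₁ - m₁ * l₀ + n₃ ≠ 0 := by
  intro hF
  have hn₂ : n₂ = 0 := by
    have h1 : n₂ ^ 2 * (x₀ * y₁ - x₁ * y₀) = 0 := by
      linear_combination (m₁ * s) * p2 - (m₁ * s') * p1 - (n₂ * x₀) * r2 + (n₂ * y₀) * r1
    exact pow_eq_zero_iff (two_ne_zero) |>.1 ((mul_eq_zero.1 h1).resolve_right hE)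
  subst hn₂
  have hm₀ : m₀ = 0 := by
    refine (mul_eq_zero.1 ?_).resolve_right hS
    linear_combination q' * p1 - q * p2
  have hm₁ : m₁ = 0 := by
    refine (mul_eq_zero.1 ?_).resolve_right hS
    linear_combination q' * r1 - q * r2
  subst hm₀ hm₁
  have hn₃ : n₃ = 0 := by linear_combination hF
  subst hn₃
  apply hdet
  ring

theorem not_isFlat_of_12_14_24
    (h : SatisfiesEquations e ![[], [], [], [(0, 1)], [(0, 3)], [(1, 3)]])
    (S : CPStructure g) : ¬ S.IsFlat := by
  obtain ⟨ht, hJ⟩ := lastTwo_stable_of_12_14_24 h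
  obtain ⟨F⟩ := ht.nonempty_towerFrame hJ S
  have hlie : ∀ i j x, (∀ k, e.coord k ⁅e i, e j⁆ = e.coord k x) → ⁅e i, e j⁆ = x :=
    fun i j x => eq_of_coord_eq
  have b02 : ⁅e 0, e 2⁆ = 0 := hlie _ _ _ fun k => by
    rw [h.coord_lie]
    fin_cases k <;> simp [twoForm, -Module.Basis.coord_apply, coord_basis]
  have b03 : ⁅e 0, e 3⁆ = -e 4 := hlie _ _ _ fun k => by
    rw [h.coord_lie]
    fin_cases k <;> simp [twoForm, -Module.Basis.coord_apply, coord_basis]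
  have b12 : ⁅e 1, e 2⁆ = 0 := hlie _ _ _ fun k => by
    rw [h.coord_lie]
    fin_cases k <;> simp [twoForm, -Module.Basis.coord_apply, coord_basis]
  have b13 : ⁅e 1, e 3⁆ = -e 5 := hlie _ _ _ fun k => by
    rw [h.coord_lie]
    fin_cases k <;> simp [twoForm, -Module.Basis.coord_apply, coord_basis]
  have hdet := F.det_ne_zero_of_neg_basis (i := 4) (j := 5) (by decide)
    (b03.symm.trans F.lie_zero_three) (b13.symm.trans F.lie_one_three)
  obtain ⟨p1, p2⟩ := F.eq_zero_of_lie_eq F.lie_zero_two b02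
  obtain ⟨r1, r2⟩ := F.eq_zero_of_lie_eq F.lie_one_two b12
  rw [F.isFlat_iff]
  exact curvature_coefficient_ne_zero F.det_ne_zero F.det_ne_zero' hdet p1 p2 r1 r2

/-- From `[e₀,e₃] = 0` follow `n₃ = m₀l₁` and `m₀l₀ = 0`. Suppose the coefficient is zero. If `m₀ =
0`, then `m₁l₀ = 0` and `[e₀,e₂]`, `[e₁,e₃]` are both proportional to `(x₀,y₀)`; if `m₀ ≠ 0`, then
`l₀ = l₁ = 0`, so `q = q' = 0`. -/
theorem curvature_coefficient_ne_zero' {x₀ y₀ x₁ y₁ s s' q q' l₀ l₁ m₀ m₁ n₂ n₃ : ℝ}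
    (hE : x₀ * y₁ - x₁ * y₀ ≠ 0)
    (hS : s * q' - q * s' ≠ 0) (hq : q = l₁ * x₀ - l₀ * x₁)
    (hq' : q' = l₁ * y₀ - l₀ * y₁)
    (hdet : (m₀ * s - n₂ * x₀) * (m₁ * q' - n₃ * y₁) - (m₁ * q - n₃ * x₁) * (m₀ * s' - n₂ * y₀) ≠ 0)
    (p1 : m₀ * q - n₃ * x₀ = 0) (p2 : m₀ * q' - n₃ * y₀ = 0) :
    m₀ * l₁ - m₁ * l₀ + n₃ ≠ 0 := by
  subst hq hq'
  intro hF
  obtain ⟨k1, k2⟩ := eq_zero_of_det_ne_zero (a := m₀ * l₁ - n₃) (b := -(m₀ * l₀)) hE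
    (by linear_combination p1) (by linear_combination p2)
  by_cases hm₀ : m₀ = 0
  · subst hm₀
    have hn₃ : n₃ = 0 := by linear_combination -k1
    subst hn₃
    have h1 : m₁ * l₀ = 0 := by linear_combination -hF
    apply hdet
    linear_combination (n₂ * (x₀ * y₁ - x₁ * y₀)) * h1
  · have hl₀ : l₀ = 0 := (mul_eq_zero.1 (neg_eq_zero.1 k2)).resolve_left hm₀
    subst hl₀
    have h1 : m₀ * l₁ = 0 := by linear_combination (1 / 2 : ℝ) * (k1 + hF)
    have hl₁ : l₁ = 0 := (mul_eq_zero.1 h1).resolve_left hm₀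
    subst hl₁
    apply hS
    ring

theorem not_isFlat_of_12_13_24
    (h : SatisfiesEquations e ![[], [], [], [(0, 1)], [(0, 2)], [(1, 3)]])
    (S : CPStructure g) : ¬ S.IsFlat := by
  obtain ⟨ht, hJ⟩ := lastTwo_stable_of_12_13_24 h
  obtain ⟨F⟩ := ht.nonempty_towerFrame hJ S
  have hlie : ∀ i j x, (∀ k, e.coord k ⁅e i, e j⁆ = e.coord k x) → ⁅e i, e j⁆ = x :=
    fun i j x => eq_of_coord_eq
  have b02 : ⁅e 0, e 2⁆ = -e 4 := hlie _ _ _ fun k => by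
    rw [h.coord_lie]
    fin_cases k <;> simp [twoForm, -Module.Basis.coord_apply, coord_basis]
  have b03 : ⁅e 0, e 3⁆ = 0 := hlie _ _ _ fun k => by
    rw [h.coord_lie]
    fin_cases k <;> simp [twoForm, -Module.Basis.coord_apply, coord_basis]
  have b13 : ⁅e 1, e 3⁆ = -e 5 := hlie _ _ _ fun k => by
    rw [h.coord_lie]
    fin_cases k <;> simp [twoForm, -Module.Basis.coord_apply, coord_basis]
  have hdet := F.det_ne_zero_of_neg_basis (i := 4) (j := 5) (by decide)
    (b02.symm.trans F.lie_zero_two) (b13.symm.trans F.lie_one_three)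
  obtain ⟨p1, p2⟩ := F.eq_zero_of_lie_eq F.lie_zero_three b03
  rw [F.isFlat_iff]
  exact curvature_coefficient_ne_zero' F.det_ne_zero F.det_ne_zero' F.q_eq F.q'_eq hdet p1 p2

end ComplexProduct

/-! ### Complex product structures from coordinate data -/

namespace ComplexProduct

variable {g : Type*} [LieRing g] [LieAlgebra ℝ g] {e : Module.Basis (Fin 6) ℝ g} {t : Tuple}
  {J E : (Fin 6 → ℝ) → Fin 6 → ℝ} {n : (Fin 6 → ℝ) → (Fin 6 → ℝ) → Fin 6 → ℝ}

/-- A torsion-free connection with `∇J = ∇E = 0` is the one determined by `{J, E}`; linearity need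
not be assumed. -/
theorem CPStructure.connection_apply_eq (S : CPStructure g) {f : g → g → g}
    (htor : ∀ x y, f x y - f y x = ⁅x, y⁆) (hJ : ∀ x y, f x (S.J y) = S.J (f x y))
    (hE : ∀ x y, f x (S.E y) = S.E (f x y)) (x y : g) : S.connection x y = f x y := by
  let d (x y : g) : g := S.connection x y - f x y
  have hs : ∀ x y, d x y = d y x := fun x y => by
    have := (S.connection_sub x y).trans (htor x y).symm
    linear_combination (norm := module) this
  have dJ : ∀ x y, d x (S.J y) = S.J (d x y) := fun x y => by
    simp only [d, hJ, S.connection_J, map_sub]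
  have dE : ∀ x y, d x (S.E y) = S.E (d x y) := fun x y => by
    simp only [d, hE, S.connection_E, map_sub]
  have h1 : S.J (S.E (d x y)) = S.E (S.J (d x y)) := by
    rw [← dE, hs, ← dJ, hs, dE, hs, dJ, hs y x]
  have h2 : S.J (S.E (d x y)) = 0 := by
    rw [S.E_J] at h1
    refine (smul_eq_zero.1 (?_ : (2 : ℝ) • S.J (S.E (d x y)) = 0)).resolve_left two_ne_zero
    linear_combination (norm := module) h1
  have h3 := congrArg S.E (S.J_eq_zero h2)
  rw [S.product.sq, map_zero] at h3
  exact sub_eq_zero.1 h3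

variable (t J E n) in
/-- In coordinates, `J`, `E` define a complex product structure on the Lie algebra denoted by the
tuple `t`, and `n` is the associated connection. -/
structure IsCPTriple : Prop where
  J_add : ∀ x y, J (x + y) = J x + J y
  J_smul : ∀ (c : ℝ) x, J (c • x) = c • J x
  E_add : ∀ x y, E (x + y) = E x + E y
  E_smul : ∀ (c : ℝ) x, E (c • x) = c • E x
  sq_J : ∀ x, J (J x) = -x
  sq_E : ∀ x, E (E x) = x
  anticomm : ∀ x, J (E x) = -E (J x)
  torsionFree : ∀ x y, n x y - n y x = tupleBracket t x y
  parallel_J : ∀ x y, n x (J y) = J (n x y)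
  parallel_E : ∀ x y, n x (E y) = E (n x y)

theorem SatisfiesEquations.equivFun_lie (h : SatisfiesEquations e t) (x y : g) :
    e.equivFun ⁅x, y⁆ = tupleBracket t (e.equivFun x) (e.equivFun y) := by
  funext k
  exact h.coord_lie k x y

namespace IsCPTriple

variable (e) in
/-- The endomorphism `J` of `g`, from its expression in coordinates. -/
noncomputable def endJ (hp : IsCPTriple t J E n) : g →ₗ[ℝ] g where
  toFun x := e.equivFun.symm (J (e.equivFun x))
  map_add' x y := by rw [map_add, hp.J_add, map_add]
  map_smul' c x := by rw [map_smul, hp.J_smul, map_smul, RingHom.id_apply]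

variable (e) in
/-- The endomorphism `E` of `g`, from its expression in coordinates. -/
noncomputable def endE (hp : IsCPTriple t J E n) : g →ₗ[ℝ] g where
  toFun x := e.equivFun.symm (E (e.equivFun x))
  map_add' x y := by rw [map_add, hp.E_add, map_add]
  map_smul' c x := by rw [map_smul, hp.E_smul, map_smul, RingHom.id_apply]

theorem equivFun_endJ (hp : IsCPTriple t J E n) (x : g) :
    e.equivFun (hp.endJ e x) = J (e.equivFun x) := e.equivFun.apply_symm_apply _

theorem equivFun_endE (hp : IsCPTriple t J E n) (x : g) :
    e.equivFun (hp.endE e x) = E (e.equivFun x) := e.equivFun.apply_symm_apply _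

theorem J_sub (hp : IsCPTriple t J E n) (x y : Fin 6 → ℝ) : J (x - y) = J x - J y := by
  rw [eq_sub_iff_add_eq, ← hp.J_add, sub_add_cancel]

theorem E_sub (hp : IsCPTriple t J E n) (x y : Fin 6 → ℝ) : E (x - y) = E x - E y := by
  rw [eq_sub_iff_add_eq, ← hp.E_add, sub_add_cancel]

/-- The complex product structure on `g` with the given expression in coordinates. -/
noncomputable def toCPStructure (hp : IsCPTriple t J E n) (h : SatisfiesEquations e t) :
    CPStructure g where
  J := hp.endJ e
  E := hp.endE e
  complex :=
    { sq := fun x => e.equivFun.injective (by simp only [equivFun_endJ, hp.sq_J, map_neg])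
      -- Written as antisymmetrized `n`, the brackets satisfy the integrability condition because
      -- `J` is parallel; the same works for `E` below.
      integrable := fun x y => e.equivFun.injective (by
        simp only [equivFun_endJ, map_add, h.equivFun_lie, ← hp.torsionFree, hp.J_sub,
          hp.parallel_J, hp.sq_J]
        abel) }
  product := by
    -- A non-zero multiple of the identity commutes with `J`, so anticommutation would force `J = 0`
    -- on `e 0`.
    have hs : ∀ a : ℝ, a ≠ 0 → hp.endE e ≠ a • LinearMap.id := by
      intro a ha h1
      have h2 := hp.anticomm (e.equivFun (e 0))
      rw [← equivFun_endE hp, ← equivFun_endJ hp, ← equivFun_endJ hp, ← equivFun_endE hp, h1,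
        ← map_neg, e.equivFun.injective.eq_iff] at h2
      simp only [LinearMap.smul_apply, LinearMap.id_apply, map_smul] at h2
      have h3 : hp.endJ e (e 0) = 0 := by
        refine (smul_eq_zero.1 (?_ : (2 * a) • hp.endJ e (e 0) = 0)).resolve_left
          (by simpa using ha)
        linear_combination (norm := module) h2
      have h4 := hp.sq_J (e.equivFun (e 0))
      rw [← equivFun_endJ hp, ← equivFun_endJ hp, h3, map_zero, map_zero, zero_eq_neg,
        LinearEquiv.map_eq_zero_iff] at h4
      exact e.ne_zero 0 h4
    exact
    { sq := fun x => e.equivFun.injective (by simp only [equivFun_endE, hp.sq_E])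
      ne_id := by simpa using hs 1 one_ne_zero
      ne_neg_id := by simpa using hs (-1) (by norm_num)
      integrable := fun x y => e.equivFun.injective (by
        simp only [equivFun_endE, map_add, map_sub, h.equivFun_lie, ← hp.torsionFree, hp.E_sub,
          hp.parallel_E, hp.sq_E]
        abel) }
  anticomm := fun x => e.equivFun.injective (by
    simp only [equivFun_endE, equivFun_endJ, map_neg, hp.anticomm])

theorem equivFun_connection (hp : IsCPTriple t J E n) (h : SatisfiesEquations e t) (x y : g) :
    e.equivFun ((hp.toCPStructure h).connection x y) = n (e.equivFun x) (e.equivFun y) := by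
  rw [(hp.toCPStructure h).connection_apply_eq
    (f := fun x y => e.equivFun.symm (n (e.equivFun x) (e.equivFun y))), LinearEquiv.apply_symm_apply]
  · intro x y
    refine e.equivFun.injective ?_
    rw [map_sub, LinearEquiv.apply_symm_apply, LinearEquiv.apply_symm_apply, h.equivFun_lie,
      hp.torsionFree]
  · intro x y
    refine e.equivFun.injective ?_
    simp only [toCPStructure, equivFun_endJ, LinearEquiv.apply_symm_apply, hp.parallel_J]
  · intro x y
    refine e.equivFun.injective ?_
    simp only [toCPStructure, equivFun_endE, LinearEquiv.apply_symm_apply, hp.parallel_E]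

theorem equivFun_curvature (hp : IsCPTriple t J E n) (h : SatisfiesEquations e t) (x y z : g) :
    e.equivFun ((hp.toCPStructure h).curvature x y z) =
      n (e.equivFun x) (n (e.equivFun y) (e.equivFun z))
        - n (e.equivFun y) (n (e.equivFun x) (e.equivFun z))
        - n (tupleBracket t (e.equivFun x) (e.equivFun y)) (e.equivFun z) := by
  simp only [CPStructure.curvature, map_sub, hp.equivFun_connection h, h.equivFun_lie]

theorem isFlat (hp : IsCPTriple t J E n) (h : SatisfiesEquations e t)
    (hflat : ∀ x y z, n x (n y z) - n y (n x z) - n (tupleBracket t x y) z = 0) :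
    (hp.toCPStructure h).IsFlat := fun x y z => e.equivFun.injective (by
  rw [hp.equivFun_curvature h, hflat, map_zero])

theorem not_isFlat (hp : IsCPTriple t J E n) (h : SatisfiesEquations e t) (x y z : Fin 6 → ℝ)
    (k : Fin 6) (hk : (n x (n y z) - n y (n x z) - n (tupleBracket t x y) z) k ≠ 0) :
    ¬ (hp.toCPStructure h).IsFlat := fun hf => hk (by
  have h1 := hp.equivFun_curvature h (e.equivFun.symm x) (e.equivFun.symm y) (e.equivFun.symm z)
  rw [hf, map_zero] at h1
  simp only [LinearEquiv.apply_symm_apply] at h1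
  rw [← h1, Pi.zero_apply])

end IsCPTriple

end ComplexProduct

/-! ### Explicit structures on the fifteen algebras, and conclusion -/

namespace ComplexProduct

variable {g : Type*} [LieRing g] [LieAlgebra ℝ g] {e : Module.Basis (Fin 6) ℝ g}

theorem isCPTriple_zero :
    IsCPTriple ![[], [], [], [], [], []]
      (fun x => ![-x 1, x 0, -x 3, x 2, -x 5, x 4])
      (fun x => ![x 0, -x 1, x 2, -x 3, x 4, -x 5])
      (fun _ _ => ![0, 0, 0, 0, 0, 0]) := by
  constructor <;> intros <;> funext k <;> fin_cases k <;> simp [tupleBracket, twoForm] <;> ring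

theorem isCPTriple_12 :
    IsCPTriple ![[], [], [], [], [], [(0, 1)]]
      (fun x => ![-x 1, x 0, -x 3, x 2, x 5, -x 4])
      (fun x => ![x 0, -x 1, x 2, -x 3, x 4, -x 5])
      (fun x y => ![0, 0, 0, 0, x 0 * y 0, -x 0 * y 1]) := by
  constructor <;> intros <;> funext k <;> fin_cases k <;> simp [tupleBracket, twoForm] <;> ring

theorem isCPTriple_12add34 :
    IsCPTriple ![[], [], [], [], [], [(0, 1), (2, 3)]]
      (fun x => ![-x 1, x 0, -x 3, x 2, x 5, -x 4])
      (fun x => ![x 0, -x 1, x 2, -x 3, x 4, -x 5])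
      (fun x y => ![0, 0, 0, 0, x 0 * y 0 + x 2 * y 2, -x 0 * y 1 - x 2 * y 3]) := by
  constructor <;> intros <;> funext k <;> fin_cases k <;> simp [tupleBracket, twoForm] <;> ring

theorem isCPTriple_12_13 :
    IsCPTriple ![[], [], [], [], [(0, 1)], [(0, 2)]]
      (fun x => ![-x 3, -x 2, x 1, x 0, -x 5, x 4])
      (fun x => ![x 0, x 1, -x 2, -x 3, x 4, -x 5])
      (fun x y => ![0, 0, 0, 0, -x 0 * y 1, -x 0 * y 2]) := by
  constructor <;> intros <;> funext k <;> fin_cases k <;> simp [tupleBracket, twoForm] <;> ring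

theorem isCPTriple_13sub24_14add23 :
    IsCPTriple ![[], [], [], [], [(0, 2), (3, 1)], [(0, 3), (1, 2)]]
      (fun x => ![-x 1, x 0, x 0 - x 3, -x 1 + x 2, -x 5, x 4])
      (fun x => ![x 0 - 2 * x 3, x 1 - 2 * x 2, -x 2, -x 3, -x 4, x 5])
      (fun x y => ![0, 0, 0, 0, -x 0 * y 2 + x 1 * y 3, x 0 * y 0 - x 0 * y 3 + x 1 * y 1 - x 1
        * y 2]) := by
  constructor <;> intros <;> funext k <;> fin_cases k <;> simp [tupleBracket, twoForm] <;> ring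

theorem isCPTriple_12_14add23 :
    IsCPTriple ![[], [], [], [], [(0, 1)], [(0, 3), (1, 2)]]
      (fun x => ![-x 1, x 0, x 3, -x 2, -x 5, x 4])
      (fun x => ![x 0, -x 1, x 2, -x 3, -x 4, x 5])
      (fun x y => ![0, 0, 0, 0, -x 0 * y 1 - x 1 * y 3 - x 3 * y 1, x 0 * y 0 - x 1 * y 2 + x 3
        * y 0]) := by
  constructor <;> intros <;> funext k <;> fin_cases k <;> simp [tupleBracket, twoForm] <;> ring

theorem isCPTriple_12_34 :
    IsCPTriple ![[], [], [], [], [(0, 1)], [(2, 3)]]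
      (fun x => ![-x 1, x 0, -x 3, x 2, x 5, -x 4])
      (fun x => ![x 0, -x 1, x 2, -x 3, -x 4, x 5])
      (fun x y => ![0, 0, 0, 0, -x 0 * y 1 + x 3 * y 3, -x 0 * y 0 + x 3 * y 2]) := by
  constructor <;> intros <;> funext k <;> fin_cases k <;> simp [tupleBracket, twoForm] <;> ring

theorem isCPTriple_12_13_23 :
    IsCPTriple ![[], [], [], [(0, 1)], [(0, 2)], [(1, 2)]]
      (fun x => ![-x 1, x 0, x 3, -x 2, -x 5, x 4])
      (fun x => ![x 0, -x 1, x 2, -x 3, x 4, -x 5])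
      (fun x y => ![0, 0, x 0 * y 0, -x 0 * y 1, x 2 * y 0, x 2 * y 1]) := by
  constructor <;> intros <;> funext k <;> fin_cases k <;> simp [tupleBracket, twoForm] <;> ring

theorem isCPTriple_12_13_14add23 :
    IsCPTriple ![[], [], [], [(0, 1)], [(0, 2)], [(0, 3), (1, 2)]]
      (fun x => ![-x 1, x 0, -x 3, x 2, -1/2 * x 5, 2 * x 4])
      (fun x => ![x 0, -x 1, x 2, -x 3, x 4, -x 5])
      (fun x y => ![0, 0, -x 0 * y 0, -x 0 * y 1, -(1/2) * x 0 * y 2 + (1/2) * x 2 * y 0, -x 0 *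
        y 3 + x 2 * y 1]) := by
  constructor <;> intros <;> funext k <;> fin_cases k <;> simp [tupleBracket, twoForm] <;> ring

theorem isCPTriple_12_14_24 :
    IsCPTriple ![[], [], [], [(0, 1)], [(0, 3)], [(1, 3)]]
      (fun x => ![-x 1, x 0, x 3, -x 2, -x 5, x 4])
      (fun x => ![x 0, -x 1, x 2, -x 3, x 4, -x 5])
      (fun x y => ![0, 0, x 0 * y 0, -x 0 * y 1, x 3 * y 0, x 3 * y 1]) := by
  constructor <;> intros <;> funext k <;> fin_cases k <;> simp [tupleBracket, twoForm] <;> ring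

theorem isCPTriple_12_13_24 :
    IsCPTriple ![[], [], [], [(0, 1)], [(0, 2)], [(1, 3)]]
      (fun x => ![x 0 + 2 * x 1, -x 0 - x 1, x 2 - x 3, 2 * x 2 - x 3, x 5, -x 4])
      (fun x => ![x 0 + 2 * x 1, -x 1, x 2, 2 * x 2 - x 3, x 4, -x 5])
      (fun x y => ![0, 0, x 0 * y 0 + x 0 * y 1 + x 1 * y 0 + x 1 * y 1, x 0 * y 0 + x 1 * y 0,
        x 1 * y 2 + x 2 * y 0 + x 2 * y 1, x 1 * y 2 - x 1 * y 3 + x 2 * y 1]) := by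
  constructor <;> intros <;> funext k <;> fin_cases k <;> simp [tupleBracket, twoForm] <;> ring

theorem isCPTriple_12_14add25_flat :
    IsCPTriple ![[], [], [], [], [(0, 1)], [(0, 3), (1, 4)]]
      (fun x => ![x 1, -x 0, x 5, x 4, -x 3, -x 2])
      (fun x => ![-x 0, x 1, x 2, x 3, -x 4, -x 5])
      (fun x y => ![0, 0, -x 1 * y 3 - x 3 * y 1, -x 1 * y 1, x 1 * y 0, -x 1 * y 4 + x 3 * y 0]) := by
  constructor <;> intros <;> funext k <;> fin_cases k <;> simp [tupleBracket, twoForm] <;> ring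

theorem exists_isFlat_12_14add25
    (h : SatisfiesEquations e ![[], [], [], [], [(0, 1)], [(0, 3), (1, 4)]]) :
    ∃ S : CPStructure g, S.IsFlat := by
  refine ⟨_, isCPTriple_12_14add25_flat.isFlat h fun x y z => ?_⟩
  funext k
  fin_cases k <;> simp [tupleBracket, twoForm] <;> ring

theorem isCPTriple_12_14add25_nonFlat :
    IsCPTriple ![[], [], [], [], [(0, 1)], [(0, 3), (1, 4)]]
      (fun x => ![x 1, -x 0, x 5, x 4, -x 3, -x 2])
      -- Relative to the flat structure, `J` is unchanged and `E` changes sign on the `J`-invariant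
      -- plane of `e 2`, `e 5`.
      (fun x => ![-x 0, x 1, -x 2, x 3, -x 4, x 5])
      (fun x y => ![0, 0, x 0 * y 4 + x 4 * y 0, -x 1 * y 1, x 1 * y 0, -x 0 * y 3 + x 4 * y 1]) := by
  constructor <;> intros <;> funext k <;> fin_cases k <;> simp [tupleBracket, twoForm] <;> ring

theorem exists_not_isFlat_12_14add25
    (h : SatisfiesEquations e ![[], [], [], [], [(0, 1)], [(0, 3), (1, 4)]]) :
    ∃ S : CPStructure g, ¬ S.IsFlat := by
  -- The witness is `R(e₀,e₁)e₀`, here `2e₂`; the same three vectors serve for the other non-flat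
  -- examples.
  refine ⟨_, isCPTriple_12_14add25_nonFlat.not_isFlat h ![1, 0, 0, 0, 0, 0]
    ![0, 1, 0, 0, 0, 0] ![1, 0, 0, 0, 0, 0] 2 ?_⟩
  simp [tupleBracket, twoForm]

theorem isCPTriple_12_13_14_flat :
    IsCPTriple ![[], [], [], [(0, 1)], [(0, 2)], [(0, 3)]]
      (fun x => ![-x 1, x 0, x 3, -x 2, x 5, -x 4])
      (fun x => ![x 0, -x 1, x 2, -x 3, x 4, -x 5])
      (fun x y => ![0, 0, x 0 * y 0, -x 0 * y 1, -x 0 * y 2, -x 0 * y 3]) := by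
  constructor <;> intros <;> funext k <;> fin_cases k <;> simp [tupleBracket, twoForm] <;> ring

theorem exists_isFlat_12_13_14
    (h : SatisfiesEquations e ![[], [], [], [(0, 1)], [(0, 2)], [(0, 3)]]) :
    ∃ S : CPStructure g, S.IsFlat := by
  refine ⟨_, isCPTriple_12_13_14_flat.isFlat h fun x y z => ?_⟩
  funext k
  fin_cases k <;> simp [tupleBracket, twoForm] <;> ring

theorem isCPTriple_12_13_14_nonFlat :
    IsCPTriple ![[], [], [], [(0, 1)], [(0, 2)], [(0, 3)]]
      (fun x => ![x 1, -x 0, -x 3, x 2, -x 5, x 4])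
      -- Relative to the flat structure, `J` is replaced by `-J` and `E` changes sign on the plane
      -- of `e 0`, `e 1` only.
      (fun x => ![-x 0, x 1, x 2, -x 3, x 4, -x 5])
      (fun x y => ![0, 0, x 1 * y 1, x 1 * y 0, -x 0 * y 2, -x 0 * y 3]) := by
  constructor <;> intros <;> funext k <;> fin_cases k <;> simp [tupleBracket, twoForm] <;> ring

theorem exists_not_isFlat_12_13_14
    (h : SatisfiesEquations e ![[], [], [], [(0, 1)], [(0, 2)], [(0, 3)]]) :
    ∃ S : CPStructure g, ¬ S.IsFlat := by
  refine ⟨_, isCPTriple_12_13_14_nonFlat.not_isFlat h ![1, 0, 0, 0, 0, 0]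
    ![0, 1, 0, 0, 0, 0] ![1, 0, 0, 0, 0, 0] 5 ?_⟩
  simp [tupleBracket, twoForm]

theorem isCPTriple_12_13add14_24_flat :
    IsCPTriple ![[], [], [], [(0, 1)], [(0, 2), (0, 3)], [(1, 3)]]
      (fun x => ![-2 * x 0 - 5 * x 1, x 0 + 2 * x 1, -1/2 * x 2 + 1/2 * x 3, -5/2 * x 2 + 1/2 *
        x 3, -x 4 - 4 * x 5, 1/2 * x 4 + x 5])
      (fun x => ![x 0 + 4 * x 1, -x 1, x 2, 2 * x 2 - x 3, x 4 + 4 * x 5, -x 5])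
      (fun x y => ![0, 0, (1/2) * x 0 * y 0 + x 0 * y 1 + x 1 * y 0 + 2 * x 1 * y 1, (1/2) * x 0
        * y 0 + x 1 * y 0, x 1 * y 2 + x 1 * y 3 + x 2 * y 0 + x 2 * y 1 + x 3 * y 0 + x 3 * y 1, (1/2)
        * x 1 * y 2 - (1/2) * x 1 * y 3 + (1/2) * x 2 * y 1 + (1/2) * x 3 * y 1]) := by
  constructor <;> intros <;> funext k <;> fin_cases k <;> simp [tupleBracket, twoForm] <;> ring

theorem exists_isFlat_12_13add14_24
    (h : SatisfiesEquations e ![[], [], [], [(0, 1)], [(0, 2), (0, 3)], [(1, 3)]]) :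
    ∃ S : CPStructure g, S.IsFlat := by
  refine ⟨_, isCPTriple_12_13add14_24_flat.isFlat h fun x y z => ?_⟩
  funext k
  fin_cases k <;> simp [tupleBracket, twoForm] <;> ring

theorem isCPTriple_12_13add14_24_nonFlat :
    IsCPTriple ![[], [], [], [(0, 1)], [(0, 2), (0, 3)], [(1, 3)]]
      (fun x => ![-3 * x 0 - 5 * x 1, 2 * x 0 + 3 * x 1, -x 3, x 2, 2 * x 4 + 5 * x 5, -x 4 - 2
        * x 5])
      (fun x => ![-3 * x 0 - 4 * x 1, 2 * x 0 + 3 * x 1, x 2, -x 3, x 4 + 4 * x 5, -x 5])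
      (fun x y => ![0, 0, -x 0 * y 0 - 2 * x 0 * y 1 - 2 * x 1 * y 0 - 4 * x 1 * y 1, x 0 * y 0
        + x 0 * y 1 + 2 * x 1 * y 0 + 2 * x 1 * y 1, -x 0 * y 2 - 2 * x 0 * y 3 - x 3 * y 0, x 0 * y 3 +
        x 3 * y 0 + x 3 * y 1]) := by
  constructor <;> intros <;> funext k <;> fin_cases k <;> simp [tupleBracket, twoForm] <;> ring

theorem exists_not_isFlat_12_13add14_24
    (h : SatisfiesEquations e ![[], [], [], [(0, 1)], [(0, 2), (0, 3)], [(1, 3)]]) :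
    ∃ S : CPStructure g, ¬ S.IsFlat := by
  refine ⟨_, isCPTriple_12_13add14_24_nonFlat.not_isFlat h ![1, 0, 0, 0, 0, 0]
    ![0, 1, 0, 0, 0, 0] ![1, 0, 0, 0, 0, 0] 4 ?_⟩
  simp [tupleBracket, twoForm]
  norm_num

theorem isCPTriple_12_14_13sub24_flat :
    IsCPTriple ![[], [], [], [(0, 1)], [(0, 3)], [(0, 2), (3, 1)]]
      (fun x => ![x 1, -x 0, x 3, -x 2, -1/2 * x 5, 2 * x 4])
      (fun x => ![-x 0, x 1, x 2, -x 3, -x 4, x 5])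
      (fun x y => ![0, 0, -x 1 * y 1, x 1 * y 0, -(1/2) * x 0 * y 3 + (1/2) * x 3 * y 0, -x 0 *
        y 2 - x 3 * y 1]) := by
  constructor <;> intros <;> funext k <;> fin_cases k <;> simp [tupleBracket, twoForm] <;> ring

theorem exists_isFlat_12_14_13sub24
    (h : SatisfiesEquations e ![[], [], [], [(0, 1)], [(0, 3)], [(0, 2), (3, 1)]]) :
    ∃ S : CPStructure g, S.IsFlat := by
  refine ⟨_, isCPTriple_12_14_13sub24_flat.isFlat h fun x y z => ?_⟩
  funext k
  fin_cases k <;> simp [tupleBracket, twoForm] <;> ring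

theorem isCPTriple_12_14_13sub24_nonFlat :
    IsCPTriple ![[], [], [], [(0, 1)], [(0, 3)], [(0, 2), (3, 1)]]
      (fun x => ![x 1, -x 0, -2 * x 3, 1/2 * x 2, x 5, -x 4])
      (fun x => ![-x 0, x 1, x 2, -x 3, -x 4, x 5])
      (fun x y => ![0, 0, 2 * x 1 * y 1, x 1 * y 0, -2 * x 0 * y 3 - x 3 * y 0, -x 0 * y 2 - x 3
        * y 1]) := by
  constructor <;> intros <;> funext k <;> fin_cases k <;> simp [tupleBracket, twoForm] <;> ring

theorem exists_not_isFlat_12_14_13sub24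
    (h : SatisfiesEquations e ![[], [], [], [(0, 1)], [(0, 3)], [(0, 2), (3, 1)]]) :
    ∃ S : CPStructure g, ¬ S.IsFlat := by
  refine ⟨_, isCPTriple_12_14_13sub24_nonFlat.not_isFlat h ![1, 0, 0, 0, 0, 0]
    ![0, 1, 0, 0, 0, 0] ![1, 0, 0, 0, 0, 0] 4 ?_⟩
  simp [tupleBracket, twoForm]
  norm_num

/-- In a Lie algebra satisfying the equations of `t`, double brackets vanish as soon as they vanish
in coordinates. -/
theorem SatisfiesEquations.two_step {t : Tuple} (h : SatisfiesEquations e t)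
    (ht : ∀ x y z : Fin 6 → ℝ, tupleBracket t x (tupleBracket t y z) = 0) (x y z : g) :
    ⁅x, ⁅y, z⁆⁆ = 0 :=
  e.equivFun.injective (by rw [h.equivFun_lie, h.equivFun_lie, ht, map_zero])

theorem SatisfiesEquations.admitsOnlyFlat_of_two_step {t : Tuple} (h : SatisfiesEquations e t)
    {J E : (Fin 6 → ℝ) → Fin 6 → ℝ} {n : (Fin 6 → ℝ) → (Fin 6 → ℝ) → Fin 6 → ℝ}
    (hp : IsCPTriple t J E n)
    (ht : ∀ x y z : Fin 6 → ℝ, tupleBracket t x (tupleBracket t y z) = 0) : AdmitsOnlyFlat g :=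
  ⟨⟨hp.toCPStructure h⟩, fun _ => CPStructure.isFlat_of_two_step (h.two_step ht)
    (by simp [Module.finrank_eq_card_basis e])⟩

theorem SatisfiesEquations.admitsOnlyFlat {t : Tuple} (h : SatisfiesEquations e t)
    (ht : t ∈ onlyFlatTuples) : AdmitsOnlyFlat g := by
  simp only [onlyFlatTuples, List.mem_cons, List.not_mem_nil, or_false] at ht
  rcases ht with rfl | rfl | rfl | rfl | rfl | rfl | rfl | rfl | rfl
  · refine h.admitsOnlyFlat_of_two_step isCPTriple_zero fun x y z => ?_
    funext k; fin_cases k <;> simp [tupleBracket, twoForm]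
  · refine h.admitsOnlyFlat_of_two_step isCPTriple_12 fun x y z => ?_
    funext k; fin_cases k <;> simp [tupleBracket, twoForm]
  · refine h.admitsOnlyFlat_of_two_step isCPTriple_12add34 fun x y z => ?_
    funext k; fin_cases k <;> simp [tupleBracket, twoForm]
  · refine h.admitsOnlyFlat_of_two_step isCPTriple_12_13 fun x y z => ?_
    funext k; fin_cases k <;> simp [tupleBracket, twoForm]
  · refine h.admitsOnlyFlat_of_two_step isCPTriple_13sub24_14add23 fun x y z => ?_
    funext k; fin_cases k <;> simp [tupleBracket, twoForm]
  · refine h.admitsOnlyFlat_of_two_step isCPTriple_12_14add23 fun x y z => ?_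
    funext k; fin_cases k <;> simp [tupleBracket, twoForm]
  · refine h.admitsOnlyFlat_of_two_step isCPTriple_12_34 fun x y z => ?_
    funext k; fin_cases k <;> simp [tupleBracket, twoForm]
  · refine h.admitsOnlyFlat_of_two_step isCPTriple_12_13_23 fun x y z => ?_
    funext k; fin_cases k <;> simp [tupleBracket, twoForm]
  · exact ⟨⟨isCPTriple_12_13_14add23.toCPStructure h⟩, isFlat_of_12_13_14add23 h⟩

theorem SatisfiesEquations.admitsOnlyNonFlat {t : Tuple} (h : SatisfiesEquations e t)
    (ht : t ∈ onlyNonFlatTuples) : AdmitsOnlyNonFlat g := by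
  simp only [onlyNonFlatTuples, List.mem_cons, List.not_mem_nil, or_false] at ht
  rcases ht with rfl | rfl
  · exact ⟨⟨isCPTriple_12_14_24.toCPStructure h⟩, not_isFlat_of_12_14_24 h⟩
  · exact ⟨⟨isCPTriple_12_13_24.toCPStructure h⟩, not_isFlat_of_12_13_24 h⟩

theorem SatisfiesEquations.admitsFlatAndNonFlat {t : Tuple} (h : SatisfiesEquations e t)
    (ht : t ∈ flatAndNonFlatTuples) : AdmitsFlatAndNonFlat g := by
  simp only [flatAndNonFlatTuples, List.mem_cons, List.not_mem_nil, or_false] at ht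
  rcases ht with rfl | rfl | rfl | rfl
  · exact ⟨exists_isFlat_12_14add25 h, exists_not_isFlat_12_14add25 h⟩
  · exact ⟨exists_isFlat_12_13_14 h, exists_not_isFlat_12_13_14 h⟩
  · exact ⟨exists_isFlat_12_13add14_24 h, exists_not_isFlat_12_13add14_24 h⟩
  · exact ⟨exists_isFlat_12_14_13sub24 h, exists_not_isFlat_12_14_13sub24 h⟩

end ComplexProduct

theorem theorem6p3 {g : Type*} [LieRing g] [LieAlgebra ℝ g] (t : ComplexProduct.Tuple)
    (ht : ComplexProduct.HasStructureEquations g t) :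
    (t ∈ ComplexProduct.onlyFlatTuples → ComplexProduct.AdmitsOnlyFlat g) ∧
    (t ∈ ComplexProduct.onlyNonFlatTuples → ComplexProduct.AdmitsOnlyNonFlat g) ∧
    (t ∈ ComplexProduct.flatAndNonFlatTuples → ComplexProduct.AdmitsFlatAndNonFlat g) := by
  obtain ⟨e, he⟩ := ht
  have h : ComplexProduct.SatisfiesEquations e t := he
  exact ⟨h.admitsOnlyFlat, h.admitsOnlyNonFlat, h.admitsFlatAndNonFlat⟩
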